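/- Let $p$ be a prime number, let $(R,\mathfrak n)$ be a commutative noetherian local ring in which $(p-1)!$ is invertible, let $G$ be a finite group acting on $R$ by ring automorphisms, and let $k\ge 1$. Filter the $G$-modules $A=\mathfrak n^k/\mathfrak n^{pk}$ and $U=(1+\mathfrak n^k)/(1+\mathfrak n^{pk})$ (the latter a subquotient of $R^\times$) by the images $F^tA$ of $\mathfrak n^t$ and $F^tU$ of $1+\mathfrak n^t$, $k\le t\le pk$ (with $F^t$ everything for $t\le k$ and trivial for $t\ge pk$). The induced filtrations of the cochain complexes $C^*(G,A)$ and $C^*(G,U)$ give two spectral sequences $$E_1^{s,t}=H^s(G,\mathfrak n^t/\mathfrak n^{t+1})\Longrightarrow H^s(G,A),\qquad E_{1}^{s,t}=H^s\bigl(G,(1+\mathfrak n^t)/(1+\mathfrak n^{t+1})\bigr)\Longrightarrow H^s(G,U),$$ with $d_r\colon E_r^{s,t}\to E_r^{s+1,t+r}$, which are concentrated in $k\le t\le pk-1$. Then: 1. The $p$-truncated exponential $x\mapsto \exp_p(x)=\sum_{i=0}^{p-1}x^i/i!$ induces an isomorphism of $G$-modules $\Phi\colon A\to U$ with $\Phi(F^tA)=F^tU$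 for all $t$; and for each $t\ge1$, $x\mapsto 1+x$ induces an isomorphism of $G$-modules $\gamma_t\colon\mathfrak n^t/\mathfrak n^{t+1}\to(1+\mathfrak n^t)/(1+\mathfrak n^{t+1})$. 2. There is an isomorphism $e$ from the first spectral sequence to the second (isomorphisms on all pages $E_r$, $r\ge 1$, commuting with the differentials and with the identifications $H(E_r)\cong E_{r+1}$) which on every page is induced by applying $\Phi$ to cochains, and which on the $E_1$-terms with $k\le t\le pk-1$ is the natural identification $H^s(G,\gamma_t)$. 3. Both spectral sequences converge: for $r\ge (p-1)k$ and $k\le t\le pk-1$ there are natural isomorphisms $E_r^{s,t}\cong F^tH^s/F^{t+1}H^s$, where $F^tH^s$ is the group of classes of cocycles with values in $F^t$. The isomorphism $H^s(G,\Phi)\colon H^s(G,A)\to H^s(G,U)$ maps $F^tH^s(G,A)$ onto $F^tH^s(G,U)$, and $e$ on $E_r$, $r\ge(p-1)k$, corresponds to the map induced by $H^s(G,\Phi)$ on associated graded groups. -/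

import Mathlib

open CategoryTheory
universe u
noncomputable section

namespace HomologyAux
variable {k : Type u} [CommRing k] {ι : Type*} {c : ComplexShape ι}
  (K : HomologicalComplex (ModuleCat.{u} k) c) (i : ι)
  {M : Type u} [AddCommGroup M] [Module k M]

/-- A linear family of cycles induces a linear map to homology, `m ↦ [f m]`. -/
def toHomology (f : M →ₗ[k] K.X i) (hf : ∀ m, K.d i (c.next i) (f m) = 0) :
    M →ₗ[k] K.homology i :=
  (K.liftCycles (ModuleCat.ofHom f) (c.next i) rfl
    (by ext m; exact hf m) ≫ K.homologyπ i).hom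

theorem homologyπ_eq_zero_iff (x : K.cycles i) :
    K.homologyπ i x = 0 ↔ ∃ y, K.d (c.prev i) i y = K.iCycles i x := by
  have h := ShortComplex.exact_of_g_is_cokernel
    (.mk (K.toCycles (c.prev i) i) (K.homologyπ i) (by simp))
    (K.homologyIsCokernel (c.prev i) i rfl)
  rw [ShortComplex.moduleCat_exact_iff] at h
  have hinj : Function.Injective (K.iCycles i) :=
    (ModuleCat.mono_iff_injective _).1 inferInstance
  have ht : ∀ y, K.iCycles i (K.toCycles (c.prev i) i y) = K.d (c.prev i) i y := fun y => by
    rw [← ConcreteCategory.comp_apply, K.toCycles_i]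
  constructor
  · intro hx
    obtain ⟨y, hy⟩ := h x hx
    exact ⟨y, by rw [← ht]; exact congrArg _ hy⟩
  · rintro ⟨y, hy⟩
    have : K.toCycles (c.prev i) i y = x := hinj (by rw [ht, hy])
    rw [← this, ← ConcreteCategory.comp_apply, K.toCycles_comp_homologyπ]
    rfl

theorem iCycles_liftCycles (f : M →ₗ[k] K.X i) (hf) (m : M) :
    K.iCycles i (K.liftCycles (ModuleCat.ofHom f) (c.next i) rfl hf m) = f m := by
  rw [← ConcreteCategory.comp_apply, K.liftCycles_i]
  rfl

theorem toHomology_eq_zero_iff (f : M →ₗ[k] K.X i) (hf : ∀ m, K.d i (c.next i) (f m) = 0) (m : M) :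
    toHomology K i f hf m = 0 ↔ ∃ y, K.d (c.prev i) i y = f m := by
  have := homologyπ_eq_zero_iff K i (K.liftCycles (ModuleCat.ofHom f) (c.next i) rfl
    (by ext m; exact hf m) m)
  rw [iCycles_liftCycles] at this
  exact this

theorem toHomology_surjective (f : M →ₗ[k] K.X i) (hf : ∀ m, K.d i (c.next i) (f m) = 0)
    (h : ∀ z, K.d i (c.next i) z = 0 → ∃ m y, z = f m + K.d (c.prev i) i y) :
    Function.Surjective (toHomology K i f hf) := by
  intro w
  obtain ⟨x, rfl⟩ := (ModuleCat.epi_iff_surjective (K.homologyπ i)).1 inferInstance w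
  obtain ⟨m, y, hm⟩ := h (K.iCycles i x) (by
    rw [← ConcreteCategory.comp_apply, K.iCycles_d]; rfl)
  refine ⟨m, ?_⟩
  refine eq_of_sub_eq_zero ?_
  have := (homologyπ_eq_zero_iff K i ((K.liftCycles (ModuleCat.ofHom f) (c.next i) rfl
    (by ext m; exact hf m) m) - x)).2 ⟨-y, by
      rw [map_neg, map_sub, iCycles_liftCycles, hm]; abel⟩
  rw [map_sub] at this
  exact this
end HomologyAux

/-- The shape of the `r`-th page: the differential goes from `(s, t)` to `(s + 1, t + r)`. -/
def pageShape (r : ℤ) : ComplexShape (ℕ × ℤ) where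
  Rel a b := a.1 + 1 = b.1 ∧ a.2 + r = b.2
  next_eq _ _ := by ext <;> lia
  prev_eq _ _ := by ext <;> lia

/-- A cochain complex of `k`-modules with a decreasing filtration by subcomplexes. -/
structure FilteredComplex (k : Type u) [CommRing k] where
  /-- the underlying cochain complex -/
  K : CochainComplex (ModuleCat.{u} k) ℕ
  /-- `F t s` is the `t`-th step of the filtration in cohomological degree `s` -/
  F : ℤ → ∀ s : ℕ, Submodule k (K.X s)
  antitone : ∀ s, Antitone fun t => F t s
  d_mem : ∀ t s s' x, x ∈ F t s → K.d s s' x ∈ F t s'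

namespace FilteredComplex
variable {k : Type u} [CommRing k] (X : FilteredComplex k)

/-- `Z_r^{s,t}`: the elements of `F^t K^s` whose differential lies in `F^{t+r} K^{s+1}`. -/
def Z (r t : ℤ) (s : ℕ) : Submodule k (X.K.X s) :=
  X.F t s ⊓ (X.F (t + r) (s + 1)).comap (X.K.d s (s + 1)).hom

/-- `B_r^{s,t}`: the elements of `F^t K^s` that are differentials of elements of
`F^{t-r+1} K^{s-1}`. -/
def B (r t : ℤ) (s : ℕ) : Submodule k (X.K.X s) :=
  X.F t s ⊓ (X.F (t - r + 1) ((ComplexShape.up ℕ).prev s)).map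
    (X.K.d ((ComplexShape.up ℕ).prev s) s).hom

/-- The submodule of `Z_r^{s,t}` by which one divides to obtain `E_r^{s,t}`. -/
def D (r t : ℤ) (s : ℕ) : Submodule k (X.K.X s) := X.Z (r - 1) (t + 1) s ⊔ X.B r t s

/-- `E_r^{s,t} = Z_r^{s,t} / (Z_{r-1}^{s,t+1} + B_r^{s,t})`. -/
abbrev E (r t : ℤ) (s : ℕ) : Type u := X.Z r t s ⧸ (X.D r t s).submoduleOf (X.Z r t s)

theorem d_d (i j l : ℕ) (x : X.K.X i) : X.K.d j l (X.K.d i j x) = 0 := by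
  rw [← ConcreteCategory.comp_apply, X.K.d_comp_d]; rfl

theorem mem_Z {r t : ℤ} {s : ℕ} {x : X.K.X s} :
    x ∈ X.Z r t s ↔ x ∈ X.F t s ∧ X.K.d s (s + 1) x ∈ X.F (t + r) (s + 1) := Iff.rfl

theorem mem_B {r t : ℤ} {s : ℕ} {x : X.K.X s} :
    x ∈ X.B r t s ↔ x ∈ X.F t s ∧ ∃ i, ∃ y ∈ X.F (t - r + 1) i, X.K.d i s y = x := by
  refine ⟨fun h => ⟨h.1, _, h.2⟩, ?_⟩
  rintro ⟨h, i, y, hy, rfl⟩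
  refine ⟨h, ?_⟩
  by_cases hi : (ComplexShape.up ℕ).Rel i s
  · obtain rfl := (ComplexShape.up ℕ).prev_eq' hi
    exact ⟨y, hy, rfl⟩
  · rw [X.K.shape _ _ hi]
    exact Submodule.zero_mem (Submodule.map _ _)

theorem mem_D {r t : ℤ} {s : ℕ} {x : X.K.X s} :
    x ∈ X.D r t s ↔ ∃ w ∈ X.Z (r - 1) (t + 1) s, ∃ i, ∃ y ∈ X.F (t - r + 1) i,
      X.K.d i s y ∈ X.F t s ∧ w + X.K.d i s y = x := by
  rw [D, Submodule.mem_sup]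
  constructor
  · rintro ⟨w, hw, b, hb, rfl⟩
    obtain ⟨h1, i, y, hy, rfl⟩ := X.mem_B.1 hb
    exact ⟨w, hw, i, y, hy, h1, rfl⟩
  · rintro ⟨w, hw, i, y, hy, h1, rfl⟩
    exact ⟨w, hw, _, X.mem_B.2 ⟨h1, i, y, hy, rfl⟩, rfl⟩

theorem F_le {t t' : ℤ} (s : ℕ) (h : t ≤ t') : X.F t' s ≤ X.F t s := X.antitone s h

theorem Z_succ_le (r t : ℤ) (s : ℕ) : X.Z (r + 1) t s ≤ X.Z r t s :=
  fun _ h => ⟨h.1, X.F_le _ (by lia) h.2⟩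

theorem d_mem_Z {r t t' : ℤ} {s s' : ℕ} (h : s + 1 = s') (h' : t + r = t') {x : X.K.X s}
    (hx : x ∈ X.Z r t s) (q : ℤ) : X.K.d s s' x ∈ X.Z q t' s' := by
  subst h h'
  refine ⟨hx.2, ?_⟩
  change X.K.d (s + 1) (s + 1 + 1) (X.K.d s (s + 1) x) ∈ X.F (t + r + q) (s + 1 + 1)
  rw [d_d]
  exact Submodule.zero_mem _

/-- The map `Z_r^{s,t} → Z_r^{s+1,t+r}` given by the differential. -/
def dZ (r : ℤ) {a b : ℕ × ℤ} (h : (pageShape r).Rel a b) :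
    X.Z r a.2 a.1 →ₗ[k] X.Z r b.2 b.1 :=
  ((X.K.d a.1 b.1).hom.restrict fun _ hx => X.d_mem_Z h.1 h.2 hx r)

theorem dZ_le (r : ℤ) {a b : ℕ × ℤ} (h : (pageShape r).Rel a b) :
    (X.D r a.2 a.1).submoduleOf (X.Z r a.2 a.1) ≤
      ((X.D r b.2 b.1).submoduleOf (X.Z r b.2 b.1)).comap (X.dZ r h) := by
  rintro ⟨x, hxZ⟩ hx
  obtain ⟨w, hw, i, y, hy, -, rfl⟩ := X.mem_D.1 hx
  refine X.mem_D.2 ⟨0, Submodule.zero_mem _, a.1, w, X.F_le _ ?_ hw.1, ?_, ?_⟩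
  · have := h.2; lia
  · have := (X.d_mem_Z h.1 (t' := b.2) (by have := h.2; lia) hw r).1
    exact this
  · change 0 + X.K.d a.1 b.1 w = X.K.d a.1 b.1 (w + X.K.d i a.1 y)
    rw [map_add, d_d]; abel

/-- The `r`-th page `E_r`; the differential `E_r^{s,t} → E_r^{s+1,t+r}` is `[x] ↦ [d x]`. -/
def page (r : ℤ) : HomologicalComplex (ModuleCat.{u} k) (pageShape r) where
  X a := ModuleCat.of k (X.E r a.2 a.1)
  d a b := by
    classical
    exact if h : (pageShape r).Rel a b then
      ModuleCat.ofHom (Submodule.mapQ _ _ (X.dZ r h) (X.dZ_le r h)) else 0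
  shape a b h := by simp [h]
  d_comp_d' a b c h h' := by
    rw [dif_pos h, dif_pos h']
    ext x
    change Submodule.Quotient.mk _ = Submodule.Quotient.mk 0
    congr 1
    exact Subtype.ext (X.d_d _ _ _ _)

/-- The class in `E_r^{s,t}` of an element of `Z_r^{s,t}`. -/
def toPage (r : ℤ) (s : ℕ) (t : ℤ) : X.Z r t s →ₗ[k] (X.page r).X (s, t) :=
  ((X.D r t s).submoduleOf (X.Z r t s)).mkQ

theorem toPage_eq_iff {r : ℤ} {s : ℕ} {t : ℤ} (x y : X.Z r t s) :
    X.toPage r s t x = X.toPage r s t y ↔ (x : X.K.X s) - y ∈ X.D r t s :=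
  Submodule.Quotient.eq _

theorem toPage_eq_zero_iff {r : ℤ} {s : ℕ} {t : ℤ} (x : X.Z r t s) :
    X.toPage r s t x = 0 ↔ (x : X.K.X s) ∈ X.D r t s :=
  Submodule.Quotient.mk_eq_zero _

theorem toPage_surjective (r : ℤ) (s : ℕ) (t : ℤ) : Function.Surjective (X.toPage r s t) :=
  Submodule.Quotient.mk_surjective _

theorem page_d_toPage {r : ℤ} {a b : ℕ × ℤ} (h : (pageShape r).Rel a b) (x : X.Z r a.2 a.1) :
    (X.page r).d a b (X.toPage r a.1 a.2 x) = X.toPage r b.1 b.2 (X.dZ r h x) := by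
  simp only [page, dif_pos h]
  rfl

/-- The map `Z_{r+1}^{s,t} → E_r^{s,t}`; its values are cycles for `d_r`. -/
def ZSuccToPage (r r' : ℤ) (h : r + 1 = r') (a : ℕ × ℤ) :
    X.Z r' a.2 a.1 →ₗ[k] (X.page r).X a :=
  X.toPage r a.1 a.2 ∘ₗ Submodule.inclusion (h ▸ X.Z_succ_le r a.2 a.1)

theorem pageShape_next (r : ℤ) (a : ℕ × ℤ) : (pageShape r).next a = (a.1 + 1, a.2 + r) :=
  (pageShape r).next_eq' ⟨rfl, rfl⟩

theorem d_ZSuccToPage (r r' : ℤ) (h : r + 1 = r') (a : ℕ × ℤ) (x : X.Z r' a.2 a.1) :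
    (X.page r).d a ((pageShape r).next a) (X.ZSuccToPage r r' h a x) = 0 := by
  subst h
  rw [pageShape_next]
  refine (X.page_d_toPage (b := (a.1 + 1, a.2 + r)) ⟨rfl, rfl⟩ _).trans ?_
  refine (X.toPage_eq_zero_iff _).2 (Submodule.mem_sup_left ?_)
  exact X.d_mem_Z rfl (by ring) x.2 _

/-- The map `Z_{r+1}^{s,t} → H(E_r)^{s,t}` that induces the identification of `E_{r+1}` with the
homology of `E_r`. -/
def ZSuccToHomology (r r' : ℤ) (h : r + 1 = r') (a : ℕ × ℤ) :
    X.Z r' a.2 a.1 →ₗ[k] (X.page r).homology a :=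
  HomologyAux.toHomology (X.page r) a (X.ZSuccToPage r r' h a) (X.d_ZSuccToPage r r' h a)

theorem ZSuccToHomology_surjective (r r' : ℤ) (h : r + 1 = r') (a : ℕ × ℤ) :
    Function.Surjective (X.ZSuccToHomology r r' h a) := by
  subst h
  refine HomologyAux.toHomology_surjective _ _ _ _ fun z hz => ?_
  obtain ⟨⟨z, hzZ⟩, rfl⟩ := X.toPage_surjective _ _ _ z
  rw [pageShape_next] at hz
  have hz' := (X.page_d_toPage (b := (a.1 + 1, a.2 + r)) ⟨rfl, rfl⟩ _).symm.trans hz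
  obtain ⟨w, hw, i, y, hy, hy', hyz⟩ := X.mem_D.1 ((X.toPage_eq_zero_iff _).1 hz')
  change w + X.K.d i (a.1 + 1) y = X.K.d a.1 (a.1 + 1) z at hyz
  -- replace `y` by an element of degree `a.1`
  obtain ⟨y, hy, hyz⟩ : ∃ y ∈ X.F (a.2 + 1) a.1, w + X.K.d a.1 (a.1 + 1) y =
      X.K.d a.1 (a.1 + 1) z := by
    by_cases hi : i = a.1
    · subst hi
      exact ⟨y, X.F_le _ (by dsimp only; lia) hy, hyz⟩
    · refine ⟨0, Submodule.zero_mem _, ?_⟩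
      rw [X.K.shape i (a.1 + 1) (by simpa using hi)] at hyz
      rw [map_zero, ← hyz]; rfl
  have hdy : X.K.d a.1 (a.1 + 1) y ∈ X.F (a.2 + r) (a.1 + 1) := by
    rw [eq_sub_of_add_eq' hyz]
    exact Submodule.sub_mem _ hzZ.2 (X.F_le _ (by lia) hw.1)
  have hzy : z - y ∈ X.Z (r + 1) a.2 a.1 := by
    refine X.mem_Z.2 ⟨Submodule.sub_mem _ hzZ.1 (X.F_le _ (by lia) hy), ?_⟩
    rw [map_sub, ← hyz, add_sub_cancel_right]
    exact X.F_le _ (by lia) hw.1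
  refine ⟨⟨z - y, hzy⟩, 0, ?_⟩
  rw [map_zero, add_zero]
  refine (X.toPage_eq_iff _ _).2 (Submodule.mem_sup_left ?_)
  change z - (z - y) ∈ _
  rw [sub_sub_cancel]
  exact X.mem_Z.2 ⟨hy, by convert! hdy using 2; ring⟩

theorem ker_ZSuccToHomology (r r' : ℤ) (h : r + 1 = r') (a : ℕ × ℤ) :
    LinearMap.ker (X.ZSuccToHomology r r' h a) =
      (X.D r' a.2 a.1).submoduleOf (X.Z r' a.2 a.1) := by
  subst h
  ext ⟨x, hx⟩
  rw [LinearMap.mem_ker, ZSuccToHomology, HomologyAux.toHomology_eq_zero_iff]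
  change _ ↔ x ∈ X.D (r + 1) a.2 a.1
  -- elements hit by the differential
  have key : (∃ y, (X.page r).d ((pageShape r).prev a) a y = X.ZSuccToPage r (r + 1) rfl a ⟨x, hx⟩) ↔
      ∃ i, ∃ y ∈ X.F (a.2 - r) i, X.K.d i a.1 y ∈ X.F a.2 a.1 ∧ x - X.K.d i a.1 y ∈ X.D r a.2 a.1 := by
    by_cases hp : ∃ b, (pageShape r).Rel b a
    · obtain ⟨b, hb⟩ := hp
      rw [(pageShape r).prev_eq' hb]
      constructor
      · rintro ⟨y, hy⟩
        obtain ⟨⟨y, hyZ⟩, rfl⟩ := X.toPage_surjective _ _ _ y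
        have hy := (X.page_d_toPage hb _).symm.trans hy
        refine ⟨b.1, y, X.F_le _ (by have := hb.2; lia) hyZ.1, ?_, ?_⟩
        · exact (X.d_mem_Z hb.1 hb.2 hyZ r).1
        · exact (X.toPage_eq_iff _ _).1 hy.symm
      · rintro ⟨i, y, hy, hyF, hyD⟩
        by_cases hi : i + 1 = a.1
        · have hib : i = b.1 := by have := hb.1; lia
          subst hib
          obtain ⟨b1, b2⟩ := b
          obtain ⟨a1, a2⟩ := a
          obtain ⟨h1, h2⟩ := hb
          dsimp only at h1 h2 hy hyF hyD
          subst h1 h2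
          refine ⟨X.toPage r b1 b2 ⟨y, X.F_le _ (by lia) hy, hyF⟩, ?_⟩
          refine (X.page_d_toPage ⟨rfl, rfl⟩ _).trans ?_
          exact ((X.toPage_eq_iff _ _).2 hyD).symm
        · refine ⟨0, ?_⟩
          rw [X.K.shape i a.1 (by simpa using hi)] at hyD
          rw [map_zero]
          refine ((X.toPage_eq_zero_iff _).2 ?_).symm
          convert! hyD using 1
          exact (sub_zero _).symm
    · have hs : ∀ i, ¬ (ComplexShape.up ℕ).Rel i a.1 := fun i hi =>
        hp ⟨(i, a.2 - r), hi, by dsimp only; lia⟩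
      rw [(X.page r).shape _ _ (fun h => hp ⟨_, h⟩)]
      constructor
      · rintro ⟨y, hy⟩
        refine ⟨0, 0, Submodule.zero_mem _, ?_, ?_⟩
        · rw [map_zero]; exact Submodule.zero_mem _
        · rw [map_zero, sub_zero]
          exact (X.toPage_eq_zero_iff (r := r) (t := a.2) _).1 hy.symm
      · rintro ⟨i, y, hy, hyF, hyD⟩
        refine ⟨0, ?_⟩
        rw [X.K.shape i a.1 (hs i)] at hyD
        refine ((X.toPage_eq_zero_iff _).2 ?_).symm
        convert! hyD using 1
        exact (sub_zero _).symm
  rw [key]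
  constructor
  · rintro ⟨i, y', hy', hyF', hD⟩
    obtain ⟨w, hw, j, y, hy, hyF, hwy⟩ := X.mem_D.1 hD
    -- both boundaries come from the same degree
    obtain ⟨l, v, hv, hvd⟩ : ∃ l, ∃ v ∈ X.F (a.2 - r) l,
        X.K.d l a.1 v = X.K.d i a.1 y' + X.K.d j a.1 y := by
      by_cases hi : (ComplexShape.up ℕ).Rel i a.1
      · by_cases hj : (ComplexShape.up ℕ).Rel j a.1
        · obtain rfl := (ComplexShape.up ℕ).prev_eq hi hj
          exact ⟨i, y' + y, Submodule.add_mem _ hy' (X.F_le _ (by lia) hy), map_add _ _ _⟩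
        · refine ⟨i, y', hy', ?_⟩
          rw [X.K.shape j a.1 hj]
          exact (add_zero _).symm
      · refine ⟨j, y, X.F_le _ (by lia) hy, ?_⟩
        rw [X.K.shape i a.1 hi]
        exact (zero_add _).symm
    have hxw : w + X.K.d l a.1 v = x := by
      rw [hvd, add_comm (X.K.d i a.1 y'), ← add_assoc, hwy, sub_add_cancel]
    refine X.mem_D.2 ⟨w, X.mem_Z.2 ⟨hw.1, ?_⟩, l, v, X.F_le _ (by lia) hv, ?_, hxw⟩
    · have h1 : X.K.d a.1 (a.1 + 1) w = X.K.d a.1 (a.1 + 1) x := by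
        rw [← hxw, map_add, d_d, add_zero]
      rw [h1]
      exact X.F_le _ (by lia) hx.2
    · rw [hvd]
      exact Submodule.add_mem _ hyF' hyF
  · intro hD
    obtain ⟨w, hw, i, y, hy, hyF, hwy⟩ := X.mem_D.1 hD
    refine ⟨i, y, X.F_le _ (by lia) hy, hyF, Submodule.mem_sup_left ?_⟩
    rw [← hwy, add_sub_cancel_right]
    exact ⟨hw.1, X.F_le _ (by lia) hw.2⟩

/-- The spectral sequence of a filtered cochain complex, starting from the page `E_1`. The
identification `H(E_r) ≅ E_{r+1}` is the usual one, induced by `Z_{r+1} ⊆ Z_r`. -/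
def spectralSequence : SpectralSequence (ModuleCat.{u} k) pageShape 1 where
  page r _ := X.page r
  iso r r' a h _ := LinearEquiv.toModuleIso
    ((Submodule.quotEquivOfEq _ _ (X.ker_ZSuccToHomology r r' h a).symm).trans
      ((X.ZSuccToHomology r r' h a).quotKerEquivOfSurjective
        (X.ZSuccToHomology_surjective r r' h a))).symm

/-- The filtration of `H^s(K)`: classes of cocycles lying in `F^t K^s`. -/
def homologyFil (t : ℤ) (s : ℕ) : Submodule k (X.K.homology s) :=
  ((X.F t s).comap (X.K.iCycles s).hom).map (X.K.homologyπ s).hom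

/-- `gr^t H^s(K) = F^t H^s(K) / F^{t+1} H^s(K)`. -/
abbrev grHomology (t : ℤ) (s : ℕ) : Type u :=
  X.homologyFil t s ⧸ (X.homologyFil (t + 1) s).submoduleOf (X.homologyFil t s)

theorem homologyπ_mem {t : ℤ} {s : ℕ} (z : X.K.cycles s) (hz : X.K.iCycles s z ∈ X.F t s) :
    X.K.homologyπ s z ∈ X.homologyFil t s := ⟨z, hz, rfl⟩

theorem iCycles_mem_Z {t : ℤ} {s : ℕ} (z : X.K.cycles s) (hz : X.K.iCycles s z ∈ X.F t s) (r : ℤ) :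
    X.K.iCycles s z ∈ X.Z r t s := by
  refine X.mem_Z.2 ⟨hz, ?_⟩
  rw [← ConcreteCategory.comp_apply, X.K.iCycles_d]
  exact Submodule.zero_mem _

/-- `ε : E_r^{s,t} ≃ gr^t H^s(K)` is the identification of `E_r = E_∞` with the graded object of
the abutment: every element of `E_r^{s,t}` is represented by a cocycle `z` in `F^t K^s`, and `ε`
sends the class of such a `z` in `E_r^{s,t}` to the class of `[z]` in `gr^t H^s(K)`. -/
structure IsEdgeEquiv (r : ℤ) (s : ℕ) (t : ℤ) (ε : (X.page r).X (s, t) ≃ₗ[k] X.grHomology t s) :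
    Prop where
  exists_rep : ∀ x : (X.page r).X (s, t), ∃ (z : X.K.cycles s) (hz : X.K.iCycles s z ∈ X.F t s),
    X.toPage r s t ⟨X.K.iCycles s z, X.iCycles_mem_Z z hz r⟩ = x
  map_rep : ∀ (z : X.K.cycles s) (hz : X.K.iCycles s z ∈ X.F t s),
    ε (X.toPage r s t ⟨X.K.iCycles s z, X.iCycles_mem_Z z hz r⟩) =
      Submodule.Quotient.mk ⟨X.K.homologyπ s z, X.homologyπ_mem z hz⟩

end FilteredComplex

/-- A representation of `G` over `k` with a decreasing filtration by subrepresentations. -/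
structure FilteredRep (k G : Type u) [CommRing k] [Group G] where
  /-- the underlying representation -/
  V : Rep.{u} k G
  /-- the filtration -/
  fil : ℤ → Submodule k V
  antitone : Antitone fil
  stable : ∀ t g, fil t ≤ (fil t).comap (V.ρ g)

namespace FilteredRep
variable {k G : Type u} [CommRing k] [Group G] (A : FilteredRep k G)

theorem submoduleOf_stable (s t : ℤ) (g : G) :
    (A.fil t).submoduleOf (A.fil s) ≤ ((A.fil t).submoduleOf (A.fil s)).comap
      ((A.V.subrepresentation (A.fil s) (A.stable s)).ρ g) :=
  fun x hx => A.stable t g (show (x : A.V) ∈ A.fil t from hx)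

/-- The subquotient representation `F^s / F^t` (for `s ≤ t`). -/
abbrev subquotient (s t : ℤ) : Rep.{u} k G :=
  (A.V.subrepresentation (A.fil s) (A.stable s)).quotient ((A.fil t).submoduleOf (A.fil s))
    (A.submoduleOf_stable s t)

/-- The class in `F^s / F^t` of an element of `F^s`. -/
abbrev toSubquotient (s t : ℤ) : A.fil s →ₗ[k] A.subquotient s t :=
  ((A.fil t).submoduleOf (A.fil s)).mkQ

/-- The associated graded representation `gr^t = F^t / F^{t+1}`. -/
abbrev gr (t : ℤ) : Rep.{u} k G := A.subquotient t (t + 1)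

/-- `F^a / F^b` with the filtration induced by that of `A`: its `t`-th step is the image of
`F^t ∩ F^a`. -/
def trunc (a b : ℤ) : FilteredRep k G where
  V := A.subquotient a b
  fil t := ((A.fil t).submoduleOf (A.fil a)).map (A.toSubquotient a b)
  antitone _ _ h := Submodule.map_mono fun _ hx => A.antitone h hx
  stable t g := by
    rintro _ ⟨x, hx, rfl⟩
    exact ⟨_, A.submoduleOf_stable a t g hx, rfl⟩

/-- The inhomogeneous cochains of `G` with values in `A`, filtered by the cochains with values in
the steps of the filtration of `A`. -/
def cochains : FilteredComplex k where
  K := groupCohomology.inhomogeneousCochains A.V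
  F t _ := Submodule.pi Set.univ fun _ => A.fil t
  antitone _ _ _ h := fun _ hx g hg => A.antitone h (hx g hg)
  d_mem t s s' x hx := by
    by_cases h : s + 1 = s'
    · subst h
      rw [groupCohomology.inhomogeneousCochains.d_def]
      intro g _
      rw [inhomogeneousCochains.d_hom_apply]
      refine Submodule.add_mem _ (A.stable t _ (hx _ trivial)) (Submodule.sum_mem _ fun j _ => ?_)
      exact Submodule.smul_mem _ _ (hx _ trivial)
    · rw [HomologicalComplex.shape _ _ _ (by simpa using h)]
      exact Submodule.zero_mem _

theorem mem_cochains_F {t : ℤ} {s : ℕ} (f : (Fin s → G) → A.V) :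
    f ∈ A.cochains.F t s ↔ ∀ g, f g ∈ A.fil t := by
  exact ⟨fun h g => h g trivial, fun h g _ => h g⟩

theorem toSubquotient_eq_zero_iff {s t : ℤ} (x : A.fil s) :
    A.toSubquotient s t x = 0 ↔ (x : A.V) ∈ A.fil t :=
  Submodule.Quotient.mk_eq_zero _

/-- Reduction of `F^t`-valued cochains to `gr^t`-valued ones. -/
def toGrCochain (t : ℤ) (s : ℕ) :
    A.cochains.F t s →ₗ[k] (groupCohomology.inhomogeneousCochains (A.gr t)).X s where
  toFun y := fun g : Fin s → G => A.toSubquotient t (t + 1) ⟨y.1 g, y.2 g trivial⟩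
  map_add' _ _ := rfl
  map_smul' _ _ := rfl

theorem toGrCochain_surjective (t : ℤ) (s : ℕ) : Function.Surjective (A.toGrCochain t s) := by
  intro z
  have h : ∀ g : Fin s → G, ∃ y : A.fil t, A.toSubquotient t (t + 1) y =
      (show (Fin s → G) → A.gr t from z) g :=
    fun g => Submodule.Quotient.mk_surjective _ _
  choose y hy using h
  exact ⟨⟨fun g => (y g : A.V), fun g _ => (y g).2⟩, funext hy⟩

theorem toGrCochain_eq_zero_iff {t : ℤ} {s : ℕ} (y : A.cochains.F t s) :
    A.toGrCochain t s y = 0 ↔ (y : A.cochains.K.X s) ∈ A.cochains.F (t + 1) s := by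
  refine Iff.trans ?_ (A.mem_cochains_F (t := t + 1) y.1).symm
  refine ⟨fun h g => ?_, fun h => funext fun g => ?_⟩
  · exact (A.toSubquotient_eq_zero_iff _).1 (congrFun h g)
  · exact (A.toSubquotient_eq_zero_iff _).2 (h g)

theorem d_toGrCochain (t : ℤ) (s s' : ℕ) (y : A.cochains.F t s) :
    (groupCohomology.inhomogeneousCochains (A.gr t)).d s s' (A.toGrCochain t s y) =
      A.toGrCochain t s' ⟨A.cochains.K.d s s' y, A.cochains.d_mem t s s' _ y.2⟩ := by
  by_cases h : s + 1 = s'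
  · subst h
    obtain ⟨y, hy⟩ := y
    have hy' : ∀ g, y g ∈ A.fil t := fun g => hy g trivial
    have e1 : A.cochains.K.d s (s + 1) = inhomogeneousCochains.d A.V s :=
      groupCohomology.inhomogeneousCochains.d_def _ _
    rw [groupCohomology.inhomogeneousCochains.d_def]
    funext g
    have e2 : A.cochains.K.d s (s + 1) y g = A.V.ρ (g 0) (y fun i => g i.succ) +
        Finset.univ.sum fun j : Fin (s + 1) =>
          (-1 : k) ^ ((j : ℕ) + 1) • y (Fin.contractNth j (· * ·) g) := by
      rw [e1]; exact inhomogeneousCochains.d_hom_apply _ _ _ _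
    let y' : (Fin s → G) → A.fil t := fun g => ⟨y g, hy' g⟩
    have e3 : (⟨A.cochains.K.d s (s + 1) y g, A.cochains.d_mem t s (s + 1) _ hy g trivial⟩ :
        A.fil t) = (⟨A.V.ρ (g 0) (y fun i => g i.succ), A.stable t _ (hy' _)⟩ : A.fil t) +
          Finset.univ.sum fun j : Fin (s + 1) =>
          (-1 : k) ^ ((j : ℕ) + 1) • y' (Fin.contractNth j (· * ·) g) := by
      refine Subtype.ext (e2.trans ?_)
      simp [y']
    refine (inhomogeneousCochains.d_hom_apply _ _ _ _).trans ?_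
    refine Eq.trans ?_ (congrArg (A.toSubquotient t (t + 1)) e3).symm
    rw [map_add, map_sum]
    simp only [map_smul]
    rfl
  · have h' : ¬ (ComplexShape.up ℕ).Rel s s' := by simpa using h
    rw [HomologicalComplex.shape _ _ _ h']
    symm
    refine (A.toGrCochain_eq_zero_iff _).2 ?_
    change A.cochains.K.d s s' _ ∈ _
    rw [HomologicalComplex.shape _ _ _ h']
    exact Submodule.zero_mem _

/-- The `gr^t`-valued cocycle underlying an element of `Z_1^{s,t}`. -/
def ZOneToGrCochain (t : ℤ) (s : ℕ) :
    A.cochains.Z 1 t s →ₗ[k] (groupCohomology.inhomogeneousCochains (A.gr t)).X s :=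
  A.toGrCochain t s ∘ₗ Submodule.inclusion inf_le_left

/-- The map `Z_1^{s,t} → H^s(G, gr^t)`. -/
def ZOneToCohomology (t : ℤ) (s : ℕ) :
    A.cochains.Z 1 t s →ₗ[k] groupCohomology (A.gr t) s :=
  HomologyAux.toHomology _ s (A.ZOneToGrCochain t s) fun z => by
    rw [CochainComplex.next ℕ s]
    refine (A.d_toGrCochain t s (s + 1) _).trans ?_
    exact (A.toGrCochain_eq_zero_iff _).2 z.2.2

theorem ZOneToCohomology_surjective (t : ℤ) (s : ℕ) :
    Function.Surjective (A.ZOneToCohomology t s) := by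
  refine HomologyAux.toHomology_surjective _ _ _ _ fun z hz => ?_
  obtain ⟨y, rfl⟩ := A.toGrCochain_surjective t s z
  rw [CochainComplex.next ℕ s, d_toGrCochain, toGrCochain_eq_zero_iff] at hz
  refine ⟨⟨y, y.2, hz⟩, 0, ?_⟩
  rw [map_zero, add_zero]
  rfl

theorem ker_ZOneToCohomology (t : ℤ) (s : ℕ) :
    LinearMap.ker (A.ZOneToCohomology t s) =
      (A.cochains.D 1 t s).submoduleOf (A.cochains.Z 1 t s) := by
  ext ⟨x, hx⟩
  rw [LinearMap.mem_ker]
  refine (HomologyAux.toHomology_eq_zero_iff _ _ _ _ _).trans ?_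
  change _ ↔ x ∈ A.cochains.D 1 t s
  rw [A.cochains.mem_D]
  constructor
  · rintro ⟨w, hw⟩
    obtain ⟨y, rfl⟩ := A.toGrCochain_surjective t _ w
    rw [d_toGrCochain] at hw
    have hw' : A.toGrCochain t s (⟨x, hx.1⟩ - ⟨A.cochains.K.d _ s y.1, A.cochains.d_mem t _ s y.1 y.2⟩)
        = 0 := by
      rw [map_sub, hw]; exact sub_self _
    have hw'' := (A.toGrCochain_eq_zero_iff _).1 hw'
    refine ⟨_, A.cochains.mem_Z.2 ⟨hw'', ?_⟩, _, y.1, A.cochains.F_le _ (by lia) y.2,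
      A.cochains.d_mem t _ s y.1 y.2, sub_add_cancel _ _⟩
    change A.cochains.K.d s (s + 1) (x - A.cochains.K.d _ s y.1) ∈ _
    rw [map_sub, A.cochains.d_d, sub_zero]
    exact A.cochains.F_le _ (by lia) hx.2
  · rintro ⟨w, hw, i, y, hy, hyF, rfl⟩
    have hy' : y ∈ A.cochains.F t i := A.cochains.F_le _ (by lia) hy
    have hb : A.toGrCochain t s ⟨w + A.cochains.K.d i s y, hx.1⟩ =
        (groupCohomology.inhomogeneousCochains (A.gr t)).d i s (A.toGrCochain t i ⟨y, hy'⟩) := by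
      rw [d_toGrCochain, ← sub_eq_zero, ← map_sub]
      refine (A.toGrCochain_eq_zero_iff _).2 ?_
      change w + A.cochains.K.d i s y - A.cochains.K.d i s y ∈ _
      rw [add_sub_cancel_right]
      exact hw.1
    by_cases hi : (ComplexShape.up ℕ).Rel i s
    · obtain rfl := (ComplexShape.up ℕ).prev_eq' hi
      exact ⟨_, hb.symm⟩
    · have h0 : (groupCohomology.inhomogeneousCochains (A.gr t)).d i s
          (A.toGrCochain t i ⟨y, hy'⟩) = 0 := by
        rw [HomologicalComplex.shape _ _ _ hi]; rfl
      exact ⟨0, (map_zero _).trans (hb.trans h0).symm⟩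

/-- The identification `E_1^{s,t} ≅ H^s(G, gr^t)`: it sends the class of an `F^t`-valued
cochain, with `F^{t+1}`-valued differential, to the class of its reduction to `gr^t`. -/
def e1Iso (t : ℤ) (s : ℕ) : (A.cochains.page 1).X (s, t) ≅ groupCohomology (A.gr t) s :=
  LinearEquiv.toModuleIso
    ((Submodule.quotEquivOfEq _ _ (A.ker_ZOneToCohomology t s).symm).trans
      ((A.ZOneToCohomology t s).quotKerEquivOfSurjective (A.ZOneToCohomology_surjective t s)))

/-- For `a ≤ t < b`, the natural map `F^t → gr^t (F^a / F^b)`. -/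
def filToGrTrunc {a b t : ℤ} (hat : a ≤ t) : A.fil t →ₗ[k] (A.trunc a b).gr t :=
  (A.trunc a b).toSubquotient t (t + 1) ∘ₗ
    LinearMap.codRestrict ((A.trunc a b).fil t)
      (A.toSubquotient a b ∘ₗ Submodule.inclusion (A.antitone hat)) (fun x => ⟨_, x.2, rfl⟩)

theorem filToGrTrunc_surjective {a b t : ℤ} (hat : a ≤ t) :
    Function.Surjective (A.filToGrTrunc (b := b) hat) := by
  intro z
  obtain ⟨⟨_, ⟨x, hx, rfl⟩⟩, rfl⟩ := Submodule.Quotient.mk_surjective _ z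
  exact ⟨⟨x, hx⟩, rfl⟩

theorem ker_filToGrTrunc {a b t : ℤ} (hat : a ≤ t) (htb : t < b) :
    LinearMap.ker (A.filToGrTrunc (b := b) hat) = (A.fil (t + 1)).submoduleOf (A.fil t) := by
  ext ⟨x, hx⟩
  rw [LinearMap.mem_ker]
  refine ((A.trunc a b).toSubquotient_eq_zero_iff _).trans ?_
  change A.toSubquotient a b ⟨x, _⟩ ∈ Submodule.map _ _ ↔ x ∈ A.fil (t + 1)
  constructor
  · rintro ⟨y, hy, hyx⟩
    have h := (A.toSubquotient_eq_zero_iff _).1 ((map_sub _ _ _).trans (sub_eq_zero.2 hyx))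
    have h' := A.antitone (show t + 1 ≤ b by lia) h
    have : x = y - (y - x) := by abel
    rw [this]
    exact Submodule.sub_mem _ hy h'
  · intro h
    exact ⟨⟨x, A.antitone hat hx⟩, h, rfl⟩

/-- For `a ≤ t < b`, the identification `gr^t A ≅ gr^t (F^a A / F^b A)`, `[x] ↦ [[x]]`. -/
def grTruncIso {a b t : ℤ} (hat : a ≤ t) (htb : t < b) : A.gr t ≅ (A.trunc a b).gr t :=
  Rep.mkIso (.mk ((Submodule.quotEquivOfEq _ _ (A.ker_filToGrTrunc hat htb).symm).trans
    ((A.filToGrTrunc (b := b) hat).quotKerEquivOfSurjective (A.filToGrTrunc_surjective hat)))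
    (by
      intro g
      ext x
      rfl))

/-- For `a ≤ t < b`, the identification `E_1^{s,t} ≅ H^s(G, F^t / F^{t+1})` in the spectral
sequence of `F^a / F^b`. -/
def truncE1Iso {a b t : ℤ} (hat : a ≤ t) (htb : t < b) (s : ℕ) :
    ((A.trunc a b).cochains.page 1).X (s, t) ≅ groupCohomology (A.gr t) s :=
  (A.trunc a b).e1Iso t s ≪≫ (groupCohomology.functor k G s).mapIso (A.grTruncIso hat htb).symm

end FilteredRep

section Units
variable (G R : Type u) [Group G] [CommRing R] [IsLocalRing R] [MulSemiringAction G R]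

open IsLocalRing

/-- The ring of integers, placed in the universe of `G` and `R`. -/
def ZU : Type u := ULift.{u} ℤ

instance : CommRing ZU.{u} := inferInstanceAs (CommRing (ULift.{u} ℤ))

/-- The identification of `ZU` with `ℤ`. -/
def ZU.toInt : ZU.{u} →+* ℤ := (ULift.ringEquiv : ULift.{u} ℤ ≃+* ℤ).toRingHom

/-- The unique structure of `ZU`-module on an abelian group. -/
abbrev zuModule (A : Type u) [AddCommGroup A] : Module ZU.{u} A := Module.compHom A ZU.toInt

/-- An abelian group with `G`-action as a representation of `G` over `ℤ`. -/
def gModule {G A : Type u} [Group G] [AddCommGroup A] (φ : G →* AddMonoid.End A) :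
    Rep.{u} ZU.{u} G :=
  letI := zuModule A
  Rep.of (X := A)
    { toFun g :=
        { toFun := φ g
          map_add' := map_add (φ g)
          map_smul' n x := map_zsmul (φ g) n.toInt x }
      map_one' := by ext x; simp
      map_mul' g h := by ext x; simp }

variable {G R} in
theorem smul_mem_maximalIdeal_pow (g : G) (n : ℕ) {x : R} (hx : x ∈ maximalIdeal R ^ n) :
    g • x ∈ maximalIdeal R ^ n := by
  have h : (maximalIdeal R).map (MulSemiringAction.toRingHom G R g) ≤ maximalIdeal R := by
    rw [Ideal.map_le_iff_le_comap]
    intro y hy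
    rw [Ideal.mem_comap, mem_maximalIdeal, mem_nonunits_iff]
    intro hu
    refine (mem_nonunits_iff.1 ((mem_maximalIdeal _).1 hy)) ?_
    have := hu.map (MulSemiringAction.toRingHom G R g⁻¹)
    simpa using this
  have := Ideal.mem_map_of_mem (MulSemiringAction.toRingHom G R g) hx
  rw [Ideal.map_pow] at this
  exact Ideal.pow_right_mono h n this

/-- The unit filtration: for `n ≥ 1` this is the subgroup `1 + 𝔫^n` of `Rˣ`, where `𝔫` is the
maximal ideal (for `n = 0` it is `Rˣ`). -/
def onePlus (n : ℕ) : Subgroup Rˣ where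
  carrier := {u | (u : R) - 1 ∈ maximalIdeal R ^ n}
  mul_mem' {u v} hu hv := by
    have h : ((u * v : Rˣ) : R) - 1 = u * ((v : R) - 1) + ((u : R) - 1) := by
      push_cast; ring
    change ((u * v : Rˣ) : R) - 1 ∈ maximalIdeal R ^ n
    rw [h]
    exact Ideal.add_mem _ (Ideal.mul_mem_left _ _ hv) hu
  one_mem' := by simp
  inv_mem' {u} hu := by
    have h : ((u⁻¹ : Rˣ) : R) - 1 = -((u⁻¹ : Rˣ) : R) * ((u : R) - 1) := by
      rw [mul_sub, neg_mul, Units.inv_mul]; ring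
    change ((u⁻¹ : Rˣ) : R) - 1 ∈ maximalIdeal R ^ n
    rw [h]
    exact Ideal.mul_mem_left _ _ hu

/-- A subgroup of an abelian group with `G`-action, as a `ℤ`-submodule. -/
def gSubmodule {G A : Type u} [Group G] [AddCommGroup A] (φ : G →* AddMonoid.End A)
    (S : AddSubgroup A) : Submodule ZU.{u} (gModule φ) where
  carrier := {x : A | x ∈ S}
  add_mem' hx hy := S.add_mem hx hy
  zero_mem' := S.zero_mem
  smul_mem' n _ hx := S.zsmul_mem hx n.toInt

/-- The action of `G` on the unit group of `R`, written additively. -/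
def unitsAction : G →* AddMonoid.End (Additive Rˣ) where
  toFun g := MonoidHom.toAdditive (Units.map (MulSemiringAction.toRingHom G R g : R →* R))
  map_one' := AddMonoidHom.ext fun x =>
    congrArg Additive.ofMul (Units.ext (one_smul G ((x.toMul : Rˣ) : R)))
  map_mul' g h := AddMonoidHom.ext fun x =>
    congrArg Additive.ofMul (Units.ext (mul_smul g h ((x.toMul : Rˣ) : R)))

/-- The additive group of `R` with its `𝔫`-adic filtration: `F^t = 𝔫^t` (and `F^t = R` for
`t ≤ 0`), where `𝔫` is the maximal ideal. -/
def addFiltered : FilteredRep ZU.{u} G where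
  V := gModule (A := R) (DistribMulAction.toAddMonoidEnd G R)
  fil t := gSubmodule (A := R) (DistribMulAction.toAddMonoidEnd G R) (Submodule.toAddSubgroup (maximalIdeal R ^ t.toNat : Ideal R))
  antitone _ _ h := fun (x : R) hx =>
    Ideal.pow_le_pow_right (I := maximalIdeal R) (Int.toNat_le_toNat h)
      (show x ∈ maximalIdeal R ^ _ from hx)
  stable t g := fun _ hx => smul_mem_maximalIdeal_pow g t.toNat hx

/-- The unit group `Rˣ` (written additively) with the filtration `F^t = 1 + 𝔫^t` for `t ≥ 1`
(and `F^t = Rˣ` for `t ≤ 0`), where `𝔫` is the maximal ideal. -/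
def unitsFiltered : FilteredRep ZU.{u} G where
  V := gModule (unitsAction G R)
  fil t := gSubmodule _ (Subgroup.toAddSubgroup (onePlus R t.toNat))
  antitone _ _ h := fun _ hx => Ideal.pow_le_pow_right (Int.toNat_le_toNat h) hx
  stable t g := fun x hx => by
    have h := smul_mem_maximalIdeal_pow g t.toNat hx
    rw [smul_sub, smul_one] at h
    exact h

/-- `𝔫^k / 𝔫^{pk}` with the filtration by the images of `𝔫^t`, `k ≤ t ≤ pk`. -/
abbrev addTrunc (p k : ℕ) : FilteredRep ZU.{u} G :=
  (addFiltered G R).trunc (k : ℤ) (p * k : ℤ)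

/-- `(1 + 𝔫^k) / (1 + 𝔫^{pk})` with the filtration by the images of `1 + 𝔫^t`, `k ≤ t ≤ pk`
(for `k ≥ 1`). -/
abbrev unitsTrunc (p k : ℕ) : FilteredRep ZU.{u} G :=
  (unitsFiltered G R).trunc (k : ℤ) (p * k : ℤ)

end Units

/-- The `p`-truncated exponential `∑_{i < p} x^i / i!`. The value is the intended one as soon as
`(p - 1)!` is invertible in `R`. -/
def truncExp {R : Type u} [CommRing R] (p : ℕ) (x : R) : R :=
  ∑ i ∈ Finset.range p, Ring.inverse ((Nat.factorial i : ℕ) : R) * x ^ i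

end

/-! The truncated exponential turns sums into products modulo `𝔫^{pk}` on `𝔫^k`. By the binomial
theorem, the terms of total degree `< p` in `exp_p(x) exp_p(y)` add up to `exp_p(x + y)`, and all
other terms lie in `(𝔫^k)^p` (`truncExp_mul_sub_mem`). Moreover `exp_p(x) - 1 = x(1 + j)` with `j ∈
𝔫`. The second factor is a unit, so `exp_p(x) - 1` and `x` lie in the same ideals
(`truncExp_sub_one_mem_iff`). This gives both the kernel `𝔫^{pk}` and the exact matching of the
filtrations. Surjectivity follows by successive approximation (`exists_sub_truncExp_mem`), and
equivariance holds because `G` acts by ring automorphisms.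

Everything else is formal. `Φ` and its inverse both respect the filtrations, so they give mutually
inverse morphisms of filtered cochain complexes, hence of spectral sequences
(`spectralSequenceIso`), and they identify the filtrations on cohomology (`map_homologyFil`). On
`E_1` only the leading term survives: `exp_p(x) ≡ 1 + x` modulo `𝔫^{t+1}` for `x ∈ 𝔫^t`
(`truncExp_sub_one_add_mem`), so the induced map is that of `γ_t` (`mapPage_truncE1Iso`).

Convergence comes from the filtration having length `(p-1)k`. For `r` at least this, elements of
`Z_r` are cocycles and every boundary in `F^t` is divided out, so `E_r` is the graded group of the
abutment (`ker_ZToGrHomology`). Naturality is then read off on cocycle representatives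
(`IsEdgeEquiv.map_eq`). -/

noncomputable section

/-! ### The truncated exponential in a commutative ring -/

section TruncExp
variable {R : Type u} [CommRing R]

theorem inverse_factorial_mul {p i : ℕ} (hfac : IsUnit ((Nat.factorial (p - 1) : ℕ) : R))
    (hi : i < p) : Ring.inverse ((Nat.factorial i : ℕ) : R) * ((Nat.factorial i : ℕ) : R) = 1 := by
  refine Ring.inverse_mul_cancel _ ?_
  obtain ⟨c, hc⟩ := Nat.factorial_dvd_factorial (show i ≤ p - 1 by lia)
  rw [hc, Nat.cast_mul] at hfac
  exact isUnit_of_mul_isUnit_left hfac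

theorem inverse_factorial_mul_choose {p i j : ℕ}
    (hfac : IsUnit ((Nat.factorial (p - 1) : ℕ) : R)) (h : i + j < p) :
    Ring.inverse ((Nat.factorial (i + j) : ℕ) : R) * ((i + j).choose i : ℕ) =
      Ring.inverse ((Nat.factorial i : ℕ) : R) * Ring.inverse ((Nat.factorial j : ℕ) : R) := by
  have hi := inverse_factorial_mul hfac (show i < p by lia)
  have hj := inverse_factorial_mul hfac (show j < p by lia)
  have hij := inverse_factorial_mul hfac h
  have hc : (((i + j).choose i : ℕ) : R) * (Nat.factorial i : ℕ) * (Nat.factorial j : ℕ) =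
      (Nat.factorial (i + j) : ℕ) := by
    rw [Nat.choose_symm_add, ← Nat.add_choose_mul_factorial_mul_factorial i j]
    push_cast; ring
  -- With the three inverses as variables, the claim is a polynomial consequence of their defining
  -- relations and of `C(i+j, i) i! j! = (i+j)!`.
  generalize Ring.inverse ((Nat.factorial i : ℕ) : R) = a at *
  generalize Ring.inverse ((Nat.factorial j : ℕ) : R) = b at *
  generalize Ring.inverse ((Nat.factorial (i + j) : ℕ) : R) = c at *
  linear_combination (a * b * c) * hc + a * b * hij -
    c * (((i + j).choose i : ℕ) : R) * b * (Nat.factorial j : ℕ) * hi -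
    c * (((i + j).choose i : ℕ) : R) * hj

/-- The product expands over the square `i, j < p`. The triangle `i + j < p` gives the exponential
of the sum, and each remaining monomial `x^i y^j` has degree at least `p`. -/
theorem truncExp_mul_sub_mem {p : ℕ} (hfac : IsUnit ((Nat.factorial (p - 1) : ℕ) : R))
    {I : Ideal R} {x y : R} (hx : x ∈ I) (hy : y ∈ I) :
    truncExp p x * truncExp p y - truncExp p (x + y) ∈ I ^ p := by
  let c (i : ℕ) : R := Ring.inverse ((Nat.factorial i : ℕ) : R)
  let f (q : ℕ × ℕ) : R := c q.1 * x ^ q.1 * (c q.2 * y ^ q.2)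
  have h1 : truncExp p x * truncExp p y = ∑ q ∈ Finset.range p ×ˢ Finset.range p, f q := by
    rw [truncExp, truncExp, Finset.sum_mul_sum, Finset.sum_product]
  have h2 : truncExp p (x + y) =
      ∑ q ∈ (Finset.range p ×ˢ Finset.range p).filter (fun q => q.1 + q.2 < p), f q := by
    rw [truncExp, ← Finset.sum_fiberwise_of_maps_to (t := Finset.range p)
      (g := fun q : ℕ × ℕ => q.1 + q.2) (by intro q hq; simp at hq ⊢; lia)]
    refine Finset.sum_congr rfl fun n hn => ?_
    have hn := Finset.mem_range.1 hn
    rw [Finset.filter_filter]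
    -- Since `n < p`, the fibre of total degree `n` is the whole antidiagonal, so the binomial
    -- theorem applies to it.
    have : (Finset.range p ×ˢ Finset.range p).filter (fun q => q.1 + q.2 < p ∧ q.1 + q.2 = n) =
        Finset.HasAntidiagonal.antidiagonal n := by
      ext q; simp; lia
    rw [this, Commute.add_pow' (Commute.all x y), Finset.mul_sum]
    refine Finset.sum_congr rfl fun q hq => ?_
    obtain rfl := Finset.HasAntidiagonal.mem_antidiagonal.1 hq
    have := inverse_factorial_mul_choose hfac hn
    rw [nsmul_eq_mul, ← mul_assoc, this]
    simp only [f, c]; ring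
  rw [h1, h2, ← Finset.sum_filter_add_sum_filter_not (Finset.range p ×ˢ Finset.range p)
    (fun q => q.1 + q.2 < p), add_sub_cancel_left]
  refine Ideal.sum_mem _ fun q hq => ?_
  have hq : p ≤ q.1 + q.2 := not_lt.1 (Finset.mem_filter.1 hq).2
  have h3 : x ^ q.1 * y ^ q.2 ∈ I ^ p := by
    refine Ideal.pow_le_pow_right hq ?_
    rw [pow_add]
    exact Ideal.mul_mem_mul (Ideal.pow_mem_pow hx _) (Ideal.pow_mem_pow hy _)
  have h4 : f q = c q.1 * c q.2 * (x ^ q.1 * y ^ q.2) := by simp only [f]; ring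
  rw [h4]
  exact Ideal.mul_mem_left _ _ h3

/-- Powers of exponent at least 2 change only by `d · I` when `x` moves by `d`; the linear term of
the exponential therefore dominates its increments. -/
theorem exists_add_pow_sub_pow {I : Ideal R} {x d : R} (hx : x ∈ I) (hd : d ∈ I) (n : ℕ) :
    ∃ j ∈ I, (x + d) ^ (n + 2) - x ^ (n + 2) = d * j := by
  induction n with
  | zero => exact ⟨2 * x + d, I.add_mem (I.mul_mem_left _ hx) hd, by ring⟩
  | succ n ih =>
    obtain ⟨j, hj, h⟩ := ih
    refine ⟨(x + d) * j + x ^ (n + 1) * x, I.add_mem (I.mul_mem_left _ hj) (I.mul_mem_left _ hx), ?_⟩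
    linear_combination (x + d) * h

/-- The constant terms cancel, the linear terms leave exactly `d` (present because `p ≥ 2`), and the
higher terms contribute `d` times an element of `I`. Injectivity, surjectivity and the leading-term
estimate all rest on this. -/
theorem exists_truncExp_add_sub {p : ℕ} (hp : 2 ≤ p) {I : Ideal R} {x d : R} (hx : x ∈ I)
    (hd : d ∈ I) : ∃ j ∈ I, truncExp p (x + d) - truncExp p x = d * (1 + j) := by
  obtain ⟨q, rfl⟩ := Nat.exists_eq_add_of_le' hp
  choose j hj h using exists_add_pow_sub_pow hx hd
  refine ⟨∑ i ∈ Finset.range q, Ring.inverse ((Nat.factorial (i + 2) : ℕ) : R) * j i,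
    I.sum_mem fun i _ => I.mul_mem_left _ (hj i), ?_⟩
  rw [truncExp, truncExp, ← Finset.sum_sub_distrib, Finset.sum_range_succ', Finset.sum_range_succ',
    mul_add, Finset.mul_sum]
  have : ∀ i ∈ Finset.range q, Ring.inverse ((Nat.factorial (i + 1 + 1) : ℕ) : R) *
      (x + d) ^ (i + 1 + 1) - Ring.inverse ((Nat.factorial (i + 1 + 1) : ℕ) : R) * x ^ (i + 1 + 1) =
      d * (Ring.inverse ((Nat.factorial (i + 2) : ℕ) : R) * j i) := fun i _ => by
    linear_combination Ring.inverse ((Nat.factorial (i + 2) : ℕ) : R) * h i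
  rw [Finset.sum_congr rfl this]
  simp
  ring

theorem truncExp_zero {p : ℕ} (hp : 1 ≤ p) : truncExp p (0 : R) = 1 := by
  obtain ⟨q, rfl⟩ := Nat.exists_eq_add_of_le' hp
  simp [truncExp, Finset.sum_range_succ']

theorem exists_truncExp_eq {p : ℕ} (hp : 2 ≤ p) {I : Ideal R} {x : R} (hx : x ∈ I) :
    ∃ j ∈ I, truncExp p x - 1 = x * (1 + j) := by
  obtain ⟨j, hj, h⟩ := exists_truncExp_add_sub hp I.zero_mem hx
  rw [zero_add, truncExp_zero (by lia)] at h
  exact ⟨j, hj, h⟩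

theorem map_ringInverse {S : Type*} [CommRing S] (f : R ≃+* S) (a : R) :
    f (Ring.inverse a) = Ring.inverse (f a) := by
  by_cases h : IsUnit a
  · refine (h.map f).mul_right_injective ?_
    dsimp only
    rw [Ring.mul_inverse_cancel _ (h.map f), ← map_mul, Ring.mul_inverse_cancel _ h, map_one]
  · rw [Ring.inverse_non_unit _ h, map_zero, Ring.inverse_non_unit]
    rwa [MulEquiv.isUnit_map]

theorem map_truncExp {S : Type*} [CommRing S] (f : R ≃+* S) (p : ℕ) (x : R) :
    f (truncExp p x) = ∑ i ∈ Finset.range p, Ring.inverse ((Nat.factorial i : ℕ) : S) * f x ^ i := by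
  rw [truncExp, map_sum]
  refine Finset.sum_congr rfl fun i _ => ?_
  rw [map_mul, map_pow, ← map_natCast f i.factorial]
  congr 1
  exact map_ringInverse f _

theorem smul_truncExp {G : Type*} [Group G] [MulSemiringAction G R] (g : G) (p : ℕ) (x : R) :
    g • truncExp p x = truncExp p (g • x) :=
  map_truncExp (MulSemiringAction.toRingEquiv G R g) p x

/-! ### The truncated exponential on powers of the maximal ideal -/

variable [IsLocalRing R]
open IsLocalRing

/-- Newton-style approximation: if the error `d = u - exp_p(x)` lies in `𝔫^m`, replacing `x` by `x +
d` leaves the error `-d j` with `j ∈ 𝔫`, one step deeper. Only finitely many steps are needed, so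
completeness plays no role. -/
theorem exists_sub_truncExp_mem {p : ℕ} (hp : 2 ≤ p) {k m : ℕ} (hk : 1 ≤ k) (hkm : k ≤ m) {u : R}
    (hu : u - 1 ∈ maximalIdeal R ^ k) :
    ∃ x ∈ maximalIdeal R ^ k, u - truncExp p x ∈ maximalIdeal R ^ m := by
  induction m, hkm using Nat.le_induction with
  | base => exact ⟨0, Ideal.zero_mem _, by rwa [truncExp_zero (by lia)]⟩
  | succ m hkm ih =>
    obtain ⟨x, hx, hd⟩ := ih
    have hle : maximalIdeal R ^ k ≤ maximalIdeal R := Ideal.pow_le_self (by lia)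
    have hd' := Ideal.pow_le_pow_right hkm hd
    obtain ⟨j, hj, h⟩ := exists_truncExp_add_sub hp (hle hx) (hle hd')
    refine ⟨x + (u - truncExp p x), Ideal.add_mem _ hx hd', ?_⟩
    have : u - truncExp p (x + (u - truncExp p x)) = -((u - truncExp p x) * j) := by
      linear_combination -h
    rw [this, pow_succ]
    exact neg_mem (Ideal.mul_mem_mul hd hj)

/-- `exp_p(x) - 1` is `x` times the unit `1 + j`, `j ∈ 𝔫`. -/
theorem truncExp_sub_one_mem_iff {p : ℕ} (hp : 2 ≤ p) {I : Ideal R} {x : R}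
    (hx : x ∈ maximalIdeal R) : truncExp p x - 1 ∈ I ↔ x ∈ I := by
  obtain ⟨j, hj, h⟩ := exists_truncExp_eq hp hx
  have hu : IsUnit (1 + j) := by
    by_contra hn
    have := Ideal.sub_mem _ ((mem_maximalIdeal _).2 hn) hj
    rw [add_sub_cancel_right] at this
    exact (Ideal.ne_top_iff_one _).1 (maximalIdeal.isMaximal R).ne_top this
  rw [h, I.mul_unit_mem_iff_mem hu]

theorem truncExp_sub_one_add_mem {p : ℕ} (hp : 2 ≤ p) {t : ℕ} (ht : 1 ≤ t) {x : R}
    (hx : x ∈ maximalIdeal R ^ t) : truncExp p x - (1 + x) ∈ maximalIdeal R ^ (t + 1) := by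
  obtain ⟨j, hj, h⟩ := exists_truncExp_eq hp (Ideal.pow_le_self (show t ≠ 0 by lia) hx)
  have : truncExp p x - (1 + x) = x * j := by linear_combination h
  rw [this, pow_succ]
  exact Ideal.mul_mem_mul hx hj

end TruncExp

/-! ### Homology classes under morphisms of complexes -/

namespace HomologyAux
variable {k : Type u} [CommRing k] {ι : Type*} {c : ComplexShape ι}
  {K L : HomologicalComplex (ModuleCat.{u} k) c} (φ : K ⟶ L) (i : ι)
  {M N : Type u} [AddCommGroup M] [Module k M] [AddCommGroup N] [Module k N]

theorem iCycles_injective (K : HomologicalComplex (ModuleCat.{u} k) c) (i : ι) :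
    Function.Injective (K.iCycles i) :=
  (ModuleCat.mono_iff_injective _).1 inferInstance

theorem iCycles_cyclesMap (z : K.cycles i) :
    L.iCycles i (HomologicalComplex.cyclesMap φ i z) = φ.f i (K.iCycles i z) := by
  rw [← ConcreteCategory.comp_apply, HomologicalComplex.cyclesMap_i]; rfl

theorem homologyMap_homologyπ (z : K.cycles i) :
    HomologicalComplex.homologyMap φ i (K.homologyπ i z) =
      L.homologyπ i (HomologicalComplex.cyclesMap φ i z) := by
  rw [← ConcreteCategory.comp_apply, HomologicalComplex.homologyπ_naturality]; rfl

theorem homologyMap_toHomology (f : M →ₗ[k] K.X i) (hf : ∀ m, K.d i (c.next i) (f m) = 0)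
    (f' : N →ₗ[k] L.X i) (hf' : ∀ m, L.d i (c.next i) (f' m) = 0) {m : M} {n : N}
    (h : φ.f i (f m) = f' n) :
    HomologicalComplex.homologyMap φ i (toHomology K i f hf m) = toHomology L i f' hf' n := by
  refine (homologyMap_homologyπ φ i _).trans ?_
  refine congrArg (L.homologyπ i) (iCycles_injective L i ?_)
  rw [iCycles_cyclesMap]
  refine (congrArg (φ.f i) (iCycles_liftCycles K i f (by ext m; exact hf m) m)).trans (h.trans ?_)
  exact (iCycles_liftCycles L i f' (by ext m; exact hf' m) n).symm

end HomologyAux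

/-! ### Functoriality of the spectral sequence of a filtered complex -/

namespace FilteredComplex
variable {k : Type u} [CommRing k] {X Y : FilteredComplex k}

/-- A morphism of filtered complexes. -/
structure Hom (X Y : FilteredComplex k) where
  /-- the underlying morphism of complexes -/
  φ : X.K ⟶ Y.K
  map_mem : ∀ {t : ℤ} {s : ℕ} {x : X.K.X s}, x ∈ X.F t s → φ.f s x ∈ Y.F t s

namespace Hom
variable (f : Hom X Y)

theorem map_d (s s' : ℕ) (x : X.K.X s) : f.φ.f s' (X.K.d s s' x) = Y.K.d s s' (f.φ.f s x) := by
  rw [← ConcreteCategory.comp_apply, ← ConcreteCategory.comp_apply, f.φ.comm]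

theorem map_mem_Z {r t : ℤ} {s : ℕ} {x : X.K.X s} (hx : x ∈ X.Z r t s) :
    f.φ.f s x ∈ Y.Z r t s :=
  Y.mem_Z.2 ⟨f.map_mem hx.1, by rw [← map_d]; exact f.map_mem hx.2⟩

theorem map_mem_D {r t : ℤ} {s : ℕ} {x : X.K.X s} (hx : x ∈ X.D r t s) :
    f.φ.f s x ∈ Y.D r t s := by
  obtain ⟨w, hw, i, y, hy, hyF, rfl⟩ := X.mem_D.1 hx
  exact Y.mem_D.2 ⟨_, f.map_mem_Z hw, i, _, f.map_mem hy, by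
    rw [← map_d]; exact f.map_mem hyF, by rw [map_add, map_d]⟩

/-- The map induced on `Z_r^{s,t}`. -/
def mapZ (r t : ℤ) (s : ℕ) : X.Z r t s →ₗ[k] Y.Z r t s :=
  (f.φ.f s).hom.restrict fun _ hx => f.map_mem_Z hx

/-- The map induced on `E_r^{s,t}`. -/
def mapE (r : ℤ) (a : ℕ × ℤ) : (X.page r).X a ⟶ (Y.page r).X a :=
  ModuleCat.ofHom (Submodule.mapQ _ _ (f.mapZ r a.2 a.1) fun _ hx => f.map_mem_D hx)

/-- The map induced on the `r`-th page. -/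
def mapPage (r : ℤ) : X.page r ⟶ Y.page r where
  f a := f.mapE r a
  comm' a b h := by
    ext x
    obtain ⟨z, rfl⟩ := X.toPage_surjective _ _ _ x
    change (Y.page r).d a b (f.mapE r a _) = f.mapE r b ((X.page r).d a b _)
    refine (Y.page_d_toPage h (f.mapZ r a.2 a.1 z)).trans ?_
    refine Eq.trans ?_ (congrArg (f.mapE r b) (X.page_d_toPage h z)).symm
    refine congrArg (Y.toPage r b.1 b.2) (Subtype.ext ?_)
    exact (f.map_d _ _ _).symm

/-- Describes `H(E_r) ≅ E_{r+1}` on representatives from `Z_{r+1}`. As these represent every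
homology class, compatibility with morphisms can be tested on them. -/
theorem iso_ZSuccToHomology (X : FilteredComplex k) (r r' : ℤ) (h : r + 1 = r') (hr : 1 ≤ r)
    (a : ℕ × ℤ) (z : X.Z r' a.2 a.1) :
    (X.spectralSequence.iso r r' a h hr).hom (X.ZSuccToHomology r r' h a z) =
      X.toPage r' a.1 a.2 z := by
  exact (LinearEquiv.symm_apply_eq
    ((Submodule.quotEquivOfEq _ _ (X.ker_ZSuccToHomology r r' h a).symm).trans
      ((X.ZSuccToHomology r r' h a).quotKerEquivOfSurjective
        (X.ZSuccToHomology_surjective r r' h a)))).2 rfl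

/-- The morphism of spectral sequences induced by a morphism of filtered complexes. -/
def mapSpectralSequence : X.spectralSequence ⟶ Y.spectralSequence where
  hom r _ := f.mapPage r
  comm r r' a h hr := by
    ext x
    obtain ⟨z, rfl⟩ := X.ZSuccToHomology_surjective r r' h a x
    change (Y.spectralSequence.iso r r' a h hr).hom
        (HomologicalComplex.homologyMap (f.mapPage r) a (X.ZSuccToHomology r r' h a z)) =
      f.mapE r' a ((X.spectralSequence.iso r r' a h hr).hom _)
    have h1 : HomologicalComplex.homologyMap (f.mapPage r) a (X.ZSuccToHomology r r' h a z) =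
        Y.ZSuccToHomology r r' h a (f.mapZ r' a.2 a.1 z) :=
      HomologyAux.homologyMap_toHomology _ _ _ _ _ _ rfl
    refine (congrArg (Y.spectralSequence.iso r r' a h hr).hom h1).trans ?_
    refine (iso_ZSuccToHomology Y r r' h hr a _).trans ?_
    exact (congrArg (f.mapE r' a) (iso_ZSuccToHomology X r r' h hr a z)).symm

theorem mapPage_comp_eq_id (g : Hom Y X) (h : f.φ ≫ g.φ = 𝟙 _) (r : ℤ) :
    f.mapPage r ≫ g.mapPage r = 𝟙 _ := by
  ext a x
  obtain ⟨z, rfl⟩ := X.toPage_surjective _ _ _ x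
  refine congrArg (X.toPage r a.1 a.2) (Subtype.ext ?_)
  change (f.φ ≫ g.φ).f a.1 z.1 = z.1
  rw [h]; rfl

theorem homologyMap_mem {t : ℤ} {s : ℕ} {x : X.K.homology s} (hx : x ∈ X.homologyFil t s) :
    HomologicalComplex.homologyMap f.φ s x ∈ Y.homologyFil t s := by
  obtain ⟨z, hz, rfl⟩ := hx
  refine ⟨HomologicalComplex.cyclesMap f.φ s z, ?_, (HomologyAux.homologyMap_homologyπ f.φ s z).symm⟩
  change Y.K.iCycles s _ ∈ Y.F t s
  rw [HomologyAux.iCycles_cyclesMap]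
  exact f.map_mem hz

/-- Equality, and not just inclusion, needs the right inverse `g` to be filtered too: a class in the
target is hit by its image under `g`. -/
theorem map_homologyFil (g : Hom Y X) (h : g.φ ≫ f.φ = 𝟙 _) (t : ℤ) (s : ℕ) :
    (X.homologyFil t s).map (HomologicalComplex.homologyMap f.φ s).hom = Y.homologyFil t s := by
  refine le_antisymm (Submodule.map_le_iff_le_comap.2 fun _ hx => f.homologyMap_mem hx) fun y hy => ?_
  refine ⟨_, g.homologyMap_mem hy, ?_⟩
  change (HomologicalComplex.homologyMap g.φ s ≫ HomologicalComplex.homologyMap f.φ s) y = y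
  rw [← HomologicalComplex.homologyMap_comp, h, HomologicalComplex.homologyMap_id]
  rfl

/-- The isomorphism of spectral sequences induced by an isomorphism of filtered complexes. -/
def spectralSequenceIso (g : Hom Y X) (h : f.φ ≫ g.φ = 𝟙 _) (h' : g.φ ≫ f.φ = 𝟙 _) :
    X.spectralSequence ≅ Y.spectralSequence where
  hom := f.mapSpectralSequence
  inv := g.mapSpectralSequence
  hom_inv_id := SpectralSequence.hom_ext fun r _ => f.mapPage_comp_eq_id g h r
  inv_hom_id := SpectralSequence.hom_ext fun r _ => g.mapPage_comp_eq_id f h' r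

end Hom

/-! ### Vanishing and convergence -/

theorem isZero_page {r t : ℤ} {s : ℕ} (h : X.Z r t s ≤ X.D r t s) :
    Limits.IsZero ((X.page r).X (s, t)) := by
  have : Subsingleton (X.E r t s) :=
    Submodule.Quotient.subsingleton_iff.2 (Submodule.submoduleOf_eq_top.2 h)
  exact ModuleCat.isZero_of_subsingleton (ModuleCat.of k (X.E r t s))

/-- If `F^t = F^{t+1}` in degree `s`, then `E_r^{s,t} = 0`. -/
theorem isZero_page_of_le {r t : ℤ} {s : ℕ} (h : X.F t s ≤ X.F (t + 1) s) :
    Limits.IsZero ((X.page r).X (s, t)) :=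
  isZero_page fun _ hx => Submodule.mem_sup_left (X.mem_Z.2 ⟨h hx.1, X.F_le _ (by lia) hx.2⟩)

section Convergence
variable {r t : ℤ} {s : ℕ} (h0 : X.F (t + r) (s + 1) = ⊥)
include h0

theorem mem_Z_iff_of_eq_bot {x : X.K.X s} :
    x ∈ X.Z r t s ↔ x ∈ X.F t s ∧ X.K.d s (s + 1) x = 0 := by
  rw [mem_Z, h0, Submodule.mem_bot]

/-- If `F^{t+r}` vanishes, then the elements of `Z_r^{s,t}` are cocycles and have classes in
`gr^t H^s`. -/
def ZToHomologyFil : X.Z r t s →ₗ[k] X.homologyFil t s :=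
  LinearMap.codRestrict _
    (HomologyAux.toHomology X.K s (X.Z r t s).subtype fun z => by
      rw [CochainComplex.next ℕ s]; exact ((mem_Z_iff_of_eq_bot h0).1 z.2).2)
    fun z => ⟨_, by
      refine Eq.subst (motive := (· ∈ X.F t s)) ?_ z.2.1
      exact (HomologyAux.iCycles_liftCycles X.K s (X.Z r t s).subtype _ z).symm, rfl⟩

theorem ZToHomologyFil_iCycles (z : X.K.cycles s) (hz : X.K.iCycles s z ∈ X.F t s) :
    ZToHomologyFil h0 ⟨X.K.iCycles s z, X.iCycles_mem_Z z hz r⟩ =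
      ⟨X.K.homologyπ s z, X.homologyπ_mem z hz⟩ := by
  refine Subtype.ext (congrArg (X.K.homologyπ s) (HomologyAux.iCycles_injective _ _ ?_))
  exact HomologyAux.iCycles_liftCycles _ _ _ _ _

theorem exists_cycles_eq (x : X.Z r t s) : ∃ (z : X.K.cycles s) (hz : X.K.iCycles s z ∈ X.F t s),
    x = ⟨X.K.iCycles s z, X.iCycles_mem_Z z hz r⟩ := by
  refine ⟨X.K.liftCycles (ModuleCat.ofHom (X.Z r t s).subtype) ((ComplexShape.up ℕ).next s) rfl
    (by ext z; rw [CochainComplex.next ℕ s]; exact ((mem_Z_iff_of_eq_bot h0).1 z.2).2) x, ?_, ?_⟩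
  · rw [HomologyAux.iCycles_liftCycles]
    exact x.2.1
  · exact Subtype.ext (HomologyAux.iCycles_liftCycles X.K s (X.Z r t s).subtype _ x).symm

/-- The map `Z_r^{s,t} → gr^t H^s`. -/
def ZToGrHomology : X.Z r t s →ₗ[k] X.grHomology t s :=
  Submodule.mkQ _ ∘ₗ ZToHomologyFil h0

theorem ZToGrHomology_surjective : Function.Surjective (ZToGrHomology (X := X) h0) := by
  intro y
  obtain ⟨⟨_, z, hz, rfl⟩, rfl⟩ := Submodule.Quotient.mk_surjective _ y
  exact ⟨_, congrArg Submodule.Quotient.mk (ZToHomologyFil_iCycles h0 z hz)⟩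

/-- Since `F^{t-r+1}` is everything, `B_r` consists of all boundaries in `F^t`; since `F^{t+r}`
vanishes, `Z_{r-1}^{s,t+1}` consists of the cocycles in `F^{t+1}`. Dividing by both is dividing by
the cocycles whose class lies in `F^{t+1}H^s`. -/
theorem ker_ZToGrHomology (h1 : ∀ i, X.F (t - r + 1) i = ⊤) :
    LinearMap.ker (ZToGrHomology (X := X) h0) = (X.D r t s).submoduleOf (X.Z r t s) := by
  ext x
  obtain ⟨z, hz, rfl⟩ := exists_cycles_eq h0 x
  rw [LinearMap.mem_ker]
  change Submodule.Quotient.mk _ = _ ↔ X.K.iCycles s z ∈ X.D r t s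
  rw [Submodule.Quotient.mk_eq_zero, ZToHomologyFil_iCycles h0 z hz]
  change X.K.homologyπ s z ∈ X.homologyFil (t + 1) s ↔ _
  rw [mem_D]
  constructor
  · rintro ⟨w, hw, hwz⟩
    obtain ⟨y, hy⟩ := (HomologyAux.homologyπ_eq_zero_iff X.K s (z - w)).1 (by
      rw [map_sub]; exact sub_eq_zero.2 hwz.symm)
    rw [map_sub] at hy
    -- Nothing is known about the filtration degree of `y`, and `h1` makes this harmless.
    refine ⟨_, X.iCycles_mem_Z w hw _, _, y, h1 _ ▸ Submodule.mem_top, ?_, ?_⟩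
    · rw [hy]
      exact Submodule.sub_mem _ hz (X.F_le _ (by lia) hw)
    · rw [hy, add_sub_cancel]
  · rintro ⟨w, hw, i, y, -, -, hwy⟩
    -- The two shifts cancel, so `w` is a genuine cocycle as well.
    have h0' : X.F (t + 1 + (r - 1)) (s + 1) = ⊥ := by rw [← h0]; congr 1; ring
    obtain ⟨w', hw', hww⟩ := exists_cycles_eq h0' ⟨w, hw⟩
    obtain rfl := congrArg Subtype.val hww
    refine ⟨w', hw', (sub_eq_zero.1 ?_).symm⟩
    change X.K.homologyπ s z - X.K.homologyπ s w' = 0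
    rw [← map_sub, HomologyAux.homologyπ_eq_zero_iff, map_sub]
    by_cases hi : (ComplexShape.up ℕ).Rel i s
    · obtain rfl := (ComplexShape.up ℕ).prev_eq' hi
      exact ⟨y, by rw [← hwy, add_sub_cancel_left]⟩
    · refine ⟨0, ?_⟩
      rw [X.K.shape _ _ hi] at hwy
      rw [map_zero, ← hwy]
      exact (add_sub_cancel_left _ _).symm

/-- The identification of `E_r^{s,t}` with `gr^t H^s`, for `r` so large that `F^{t+r}` vanishes and
`F^{t-r+1}` is everything. -/
def edgeEquiv (h1 : ∀ i, X.F (t - r + 1) i = ⊤) :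
    (X.page r).X (s, t) ≃ₗ[k] X.grHomology t s :=
  (Submodule.quotEquivOfEq _ _ (ker_ZToGrHomology h0 h1).symm).trans
    ((ZToGrHomology h0).quotKerEquivOfSurjective (ZToGrHomology_surjective h0))

theorem isEdgeEquiv_edgeEquiv (h1 : ∀ i, X.F (t - r + 1) i = ⊤) :
    X.IsEdgeEquiv r s t (edgeEquiv h0 h1) where
  exists_rep x := by
    obtain ⟨x, rfl⟩ := X.toPage_surjective _ _ _ x
    obtain ⟨z, hz, rfl⟩ := exists_cycles_eq h0 x
    exact ⟨z, hz, rfl⟩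
  map_rep z hz := congrArg Submodule.Quotient.mk (ZToHomologyFil_iCycles h0 z hz)

end Convergence

/-- Both edge maps are determined on cocycle representatives, and `f` carries cocycles to cocycles.
The given `h` agrees with the class of the representative only modulo `F^{t+1}H^s`, so that
difference is transported along `f` too. -/
theorem IsEdgeEquiv.map_eq {r t : ℤ} {s : ℕ} {ε : (X.page r).X (s, t) ≃ₗ[k] X.grHomology t s}
    {ε' : (Y.page r).X (s, t) ≃ₗ[k] Y.grHomology t s} (hε : X.IsEdgeEquiv r s t ε)
    (hε' : Y.IsEdgeEquiv r s t ε') (f : Hom X Y) (x : (X.page r).X (s, t))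
    (h : X.homologyFil t s) (h' : Y.homologyFil t s) (hx : ε x = Submodule.Quotient.mk h)
    (hh' : h'.1 = HomologicalComplex.homologyMap f.φ s h.1) :
    ε' ((f.mapPage r).f (s, t) x) = Submodule.Quotient.mk h' := by
  obtain ⟨z, hz, rfl⟩ := hε.exists_rep x
  rw [hε.map_rep z hz, Submodule.Quotient.eq] at hx
  have hz' : Y.K.iCycles s (HomologicalComplex.cyclesMap f.φ s z) ∈ Y.F t s := by
    rw [HomologyAux.iCycles_cyclesMap]
    exact f.map_mem hz
  have h1 : (f.mapPage r).f (s, t)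
      (X.toPage r s t ⟨X.K.iCycles s z, X.iCycles_mem_Z z hz r⟩) =
      Y.toPage r s t ⟨_, Y.iCycles_mem_Z _ hz' r⟩ :=
    congrArg (Y.toPage r s t) (Subtype.ext (HomologyAux.iCycles_cyclesMap f.φ s z).symm)
  rw [h1, hε'.map_rep _ hz', Submodule.Quotient.eq]
  change Y.K.homologyπ s _ - h'.1 ∈ Y.homologyFil (t + 1) s
  rw [hh', ← HomologyAux.homologyMap_homologyπ, ← map_sub]
  exact f.homologyMap_mem hx

end FilteredComplex

/-! ### Filtered representations, their subquotients and the `E_1`-terms -/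

namespace FilteredRep
variable {k G : Type u} [CommRing k] [Group G] {A B : FilteredRep k G}

/-- The morphism of filtered cochain complexes induced by a filtered morphism of
representations. -/
def cochainsHom (φ : A.V ⟶ B.V) (hφ : ∀ t x, x ∈ A.fil t → φ.hom x ∈ B.fil t) :
    FilteredComplex.Hom A.cochains B.cochains where
  φ := groupCohomology.cochainsMap (MonoidHom.id G) φ
  map_mem hx g hg := hφ _ _ (hx g hg)

/-- The morphism `gr^t A ⟶ gr^t B` induced by a filtered morphism of representations. -/
def grMap (φ : A.V ⟶ B.V) (hφ : ∀ t x, x ∈ A.fil t → φ.hom x ∈ B.fil t) (t : ℤ) :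
    A.gr t ⟶ B.gr t :=
  Rep.ofHom
    { toLinearMap := Submodule.mapQ _ _
        (φ.hom.toLinearMap.restrict (p := A.fil t) (q := B.fil t) (hφ t)) fun x hx => hφ _ _ hx
      isIntertwining' g := by
        ext x
        exact congrArg (B.toSubquotient t (t + 1))
          (Subtype.ext (Rep.hom_comm_apply φ g x.1)) }

theorem grMap_toSubquotient (φ : A.V ⟶ B.V) (hφ : ∀ t x, x ∈ A.fil t → φ.hom x ∈ B.fil t) (t : ℤ)
    (x : A.fil t) : (grMap φ hφ t).hom (A.toSubquotient t (t + 1) x) =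
      B.toSubquotient t (t + 1) ⟨φ.hom x.1, hφ t _ x.2⟩ := rfl

theorem mapPage_e1Iso (φ : A.V ⟶ B.V) (hφ : ∀ t x, x ∈ A.fil t → φ.hom x ∈ B.fil t)
    (t : ℤ) (s : ℕ) :
    ((cochainsHom φ hφ).mapPage 1).f (s, t) ≫ (B.e1Iso t s).hom =
      (A.e1Iso t s).hom ≫ (groupCohomology.functor k G s).map (grMap φ hφ t) := by
  ext x
  obtain ⟨z, rfl⟩ := A.cochains.toPage_surjective _ _ _ x
  change B.ZOneToCohomology t s ((cochainsHom φ hφ).mapZ 1 t s z) =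
    HomologicalComplex.homologyMap
      (groupCohomology.cochainsMap (A := A.gr t) (B := B.gr t) (MonoidHom.id G) (grMap φ hφ t)) s (A.ZOneToCohomology t s z)
  exact (HomologyAux.homologyMap_toHomology
    (groupCohomology.cochainsMap (A := A.gr t) (B := B.gr t) (MonoidHom.id G) (grMap φ hφ t)) s
    (A.ZOneToGrCochain t s) _ (B.ZOneToGrCochain t s) _
    (m := z) (n := (cochainsHom φ hφ).mapZ 1 t s z) rfl).symm

/-- The preimage of the `t`-th step consists of sums from `F^t` and `F^b`; as the filtration is a
chain, the larger of the two, with index `min t b`, absorbs the other. -/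
theorem mem_trunc_fil {a b t : ℤ} (x : A.fil a) :
    A.toSubquotient a b x ∈ (A.trunc a b).fil t ↔ x.1 ∈ A.fil (min t b) := by
  constructor
  · rintro ⟨y, hy, hyx⟩
    have h := (A.toSubquotient_eq_zero_iff _).1 ((map_sub _ _ _).trans (sub_eq_zero.2 hyx))
    have : x.1 = y.1 - (y - x : A.fil a).1 := by push_cast; abel
    rw [this]
    exact Submodule.sub_mem _ (A.antitone (min_le_left _ _) hy) (A.antitone (min_le_right _ _) h)
  · intro h
    rcases min_choice t b with h' | h'
    · exact ⟨x, h' ▸ h, rfl⟩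
    · rw [h'] at h
      rw [(A.toSubquotient_eq_zero_iff x).2 h]
      exact Submodule.zero_mem _

theorem trunc_fil_eq_top {a b t : ℤ} (h : t ≤ a) : (A.trunc a b).fil t = ⊤ := by
  refine eq_top_iff.2 fun x _ => ?_
  obtain ⟨x, rfl⟩ := Submodule.Quotient.mk_surjective _ x
  exact ⟨x, A.antitone h x.2, rfl⟩

theorem trunc_fil_eq_bot {a b t : ℤ} (h : b ≤ t) : (A.trunc a b).fil t = ⊥ := by
  refine eq_bot_iff.2 fun x hx => ?_
  obtain ⟨x, rfl⟩ := Submodule.Quotient.mk_surjective _ x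
  have := (mem_trunc_fil x).1 hx
  rw [min_eq_right h] at this
  exact (A.toSubquotient_eq_zero_iff x).2 this

theorem trunc_cochains_F_eq_top {a b t : ℤ} (h : t ≤ a) (s : ℕ) :
    (A.trunc a b).cochains.F t s = ⊤ :=
  eq_top_iff.2 fun x _ g _ => by rw [trunc_fil_eq_top h]; trivial

theorem trunc_cochains_F_eq_bot {a b t : ℤ} (h : b ≤ t) (s : ℕ) :
    (A.trunc a b).cochains.F t s = ⊥ := by
  refine eq_bot_iff.2 fun x hx => funext fun g => ?_
  have := hx g trivial
  rw [trunc_fil_eq_bot h] at this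
  exact this

/-- Outside `a ≤ t < b` the steps `F^t` and `F^{t+1}` coincide: both are everything or both are
zero. -/
theorem isZero_trunc_page {a b r t : ℤ} (h : t < a ∨ b ≤ t) (s : ℕ) :
    Limits.IsZero (((A.trunc a b).cochains.page r).X (s, t)) := by
  refine FilteredComplex.isZero_page_of_le ?_
  rcases h with h | h
  · rw [trunc_cochains_F_eq_top (show t + 1 ≤ a by lia)]
    exact le_top
  · rw [trunc_cochains_F_eq_bot h]
    exact bot_le

theorem comp_comp_map_eq {C D : Type*} [Category* C] [Category* D] (F : C ⥤ D) {X Y : D}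
    {P Q P' Q' : C} {m : X ⟶ Y} {e : X ⟶ F.obj P} {e' : Y ⟶ F.obj Q} {g : P ⟶ Q} {i : P ⟶ P'}
    {j : Q ⟶ Q'} {γ : P' ⟶ Q'} (h : m ≫ e' = e ≫ F.map g) (h' : g ≫ j = i ≫ γ) :
    m ≫ e' ≫ F.map j = (e ≫ F.map i) ≫ F.map γ := by
  rw [← Category.assoc, h, Category.assoc, Category.assoc, ← F.map_comp, ← F.map_comp, h']

/-- If a filtered morphism `φ` between `F^a / F^b`'s and a morphism `γ` between `gr^t`'s have
representatives that agree modulo `F^{t+1}`, then `φ` induces `H^s(G, γ)` on `E_1`-terms. -/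
theorem mapPage_truncE1Iso {a b t : ℤ} (hat : a ≤ t) (htb : t < b)
    (φ : (A.trunc a b).V ⟶ (B.trunc a b).V)
    (hφ : ∀ t x, x ∈ (A.trunc a b).fil t → φ.hom x ∈ (B.trunc a b).fil t)
    (γ : A.gr t ⟶ B.gr t)
    (h : ∀ x : A.fil t, ∃ y z : B.fil t,
      φ.hom (A.toSubquotient a b ⟨x, A.antitone hat x.2⟩) =
        B.toSubquotient a b ⟨y, B.antitone hat y.2⟩ ∧
      γ.hom (A.toSubquotient t (t + 1) x) = B.toSubquotient t (t + 1) z ∧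
      (y : B.V) - z ∈ B.fil (t + 1)) (s : ℕ) :
    ((cochainsHom φ hφ).mapPage 1).f (s, t) ≫ (B.truncE1Iso hat htb s).hom =
      (A.truncE1Iso hat htb s).hom ≫ (groupCohomology.functor k G s).map γ := by
  have key : (A.grTruncIso hat htb).hom ≫ grMap φ hφ t = γ ≫ (B.grTruncIso hat htb).hom := by
    ext x
    obtain ⟨y, z, h1, h2, h3⟩ := h x
    change (grMap φ hφ t).hom (A.filToGrTrunc hat x) =
      (B.grTruncIso hat htb).hom.hom (γ.hom (A.toSubquotient t (t + 1) x))
    rw [h2]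
    change _ = B.filToGrTrunc hat z
    have h4 : (grMap φ hφ t).hom (A.filToGrTrunc hat x) = B.filToGrTrunc (b := b) hat y :=
      (grMap_toSubquotient φ hφ t _).trans
        (congrArg ((B.trunc a b).toSubquotient t (t + 1)) (Subtype.ext h1))
    rw [h4]
    -- The representatives `y` and `z` differ by an element of `F^{t+1}`, which is the kernel of
    -- `filToGrTrunc` because `t < b`.
    refine sub_eq_zero.1 ((map_sub _ _ _).symm.trans ?_)
    rw [← LinearMap.mem_ker, B.ker_filToGrTrunc hat htb]
    exact h3
  have key' : grMap φ hφ t ≫ (B.grTruncIso hat htb).inv = (A.grTruncIso hat htb).inv ≫ γ := by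
    rw [Iso.comp_inv_eq, Category.assoc, Iso.eq_inv_comp, key]
  exact comp_comp_map_eq (groupCohomology.functor k G s) (mapPage_e1Iso φ hφ t s) key'

end FilteredRep

/-! ### From the additive filtration to the unit filtration -/

section
open IsLocalRing
variable {G R : Type u} [Group G] [CommRing R] [IsLocalRing R] [MulSemiringAction G R]

theorem mem_addFiltered {t : ℤ} {x : R} :
    x ∈ (addFiltered G R).fil t ↔ x ∈ maximalIdeal R ^ t.toNat := Iff.rfl

theorem mem_unitsFiltered {t : ℤ} {u : Rˣ} :
    Additive.ofMul u ∈ (unitsFiltered G R).fil t ↔ (u : R) - 1 ∈ maximalIdeal R ^ t.toNat := Iff.rfl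

/-- `u/v - 1` is `u - v` times a unit, so multiplicative congruence of units becomes additive
congruence in `R`. -/
theorem sub_mem_unitsFiltered {t : ℤ} {u v : Rˣ} :
    (Additive.ofMul (u / v) ∈ (unitsFiltered G R).fil t) ↔
      (u : R) - v ∈ maximalIdeal R ^ t.toNat := by
  rw [mem_unitsFiltered]
  have : ((u / v : Rˣ) : R) - 1 = ((u : R) - v) * (v⁻¹ : Rˣ) := by
    rw [div_eq_mul_inv, sub_mul, Units.mul_inv, Units.val_mul]
  rw [this, Ideal.mul_unit_mem_iff_mem _ (Units.isUnit _)]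

theorem toSubquotient_units_eq_iff {a b : ℤ} {u v : Rˣ}
    (hu : Additive.ofMul u ∈ (unitsFiltered G R).fil a)
    (hv : Additive.ofMul v ∈ (unitsFiltered G R).fil a) :
    (unitsFiltered G R).toSubquotient a b ⟨Additive.ofMul u, hu⟩ =
      (unitsFiltered G R).toSubquotient a b ⟨Additive.ofMul v, hv⟩ ↔
      (u : R) - v ∈ maximalIdeal R ^ b.toNat := by
  rw [← sub_mem_unitsFiltered (G := G)]
  exact Submodule.Quotient.eq _

theorem isUnit_of_sub_one_mem {n : ℕ} (hn : 1 ≤ n) {y : R} (hy : y - 1 ∈ maximalIdeal R ^ n) :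
    IsUnit y := by
  by_contra h
  have := Ideal.sub_mem _ ((mem_maximalIdeal y).2 h) (Ideal.pow_le_self (by lia) hy)
  rw [sub_sub_cancel] at this
  exact (Ideal.ne_top_iff_one _).1 (maximalIdeal.isMaximal R).ne_top this

variable (G) in
/-- A function `f : 𝔫^a → 1 + 𝔫^a` that is an equivariant homomorphism modulo `1 + 𝔫^b`, is onto
modulo `1 + 𝔫^b`, and has "kernel" `𝔫^b`. -/
structure IsTruncIso (f : R → R) (a b : ℤ) : Prop where
  one_le : 1 ≤ a
  sub_one_mem_iff : ∀ x ∈ maximalIdeal R, ∀ n : ℕ,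
    f x - 1 ∈ maximalIdeal R ^ n ↔ x ∈ maximalIdeal R ^ n
  map_add : ∀ x ∈ maximalIdeal R ^ a.toNat, ∀ y ∈ maximalIdeal R ^ a.toNat,
    f (x + y) - f x * f y ∈ maximalIdeal R ^ b.toNat
  map_smul : ∀ (g : G) (x : R), f (g • x) = g • f x
  exists_sub_mem : ∀ y : R, y - 1 ∈ maximalIdeal R ^ a.toNat →
    ∃ x ∈ maximalIdeal R ^ a.toNat, y - f x ∈ maximalIdeal R ^ b.toNat

namespace IsTruncIso
variable {f : R → R} {a b : ℤ} (h : IsTruncIso G f a b)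
include h

theorem mem_maximalIdeal {x : R} (hx : x ∈ (addFiltered G R).fil a) : x ∈ maximalIdeal R :=
  Ideal.pow_le_self (by have := h.one_le; lia) (mem_addFiltered.1 hx)

theorem exists_unit {x : R} (hx : x ∈ (addFiltered G R).fil a) :
    ∃ u : Rˣ, (u : R) = f x ∧ Additive.ofMul u ∈ (unitsFiltered G R).fil a := by
  have h1 := (h.sub_one_mem_iff x (h.mem_maximalIdeal hx) a.toNat).2 hx
  obtain ⟨u, hu⟩ := isUnit_of_sub_one_mem (by have := h.one_le; lia) h1
  exact ⟨u, hu, by rwa [mem_unitsFiltered, hu]⟩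

/-- The unit `f x`. -/
def unit (x : (addFiltered G R).fil a) : Rˣ := (h.exists_unit x.2).choose

theorem coe_unit (x : (addFiltered G R).fil a) : (h.unit x : R) = f x.1 :=
  (h.exists_unit x.2).choose_spec.1

theorem unit_mem (x : (addFiltered G R).fil a) :
    Additive.ofMul (h.unit x) ∈ (unitsFiltered G R).fil a :=
  (h.exists_unit x.2).choose_spec.2

/-- The homomorphism `x ↦ [f x]`. -/
def toUnits : (addFiltered G R).fil a →ₗ[ZU.{u}] (unitsFiltered G R).subquotient a b :=
  let φ : (addFiltered G R).fil a →+ (unitsFiltered G R).subquotient a b :=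
    AddMonoidHom.mk' (fun x => (unitsFiltered G R).toSubquotient a b ⟨_, h.unit_mem x⟩)
      fun x y => by
        refine ((toSubquotient_units_eq_iff (v := h.unit x * h.unit y) (h.unit_mem _)
          (Submodule.add_mem _ (h.unit_mem x) (h.unit_mem y))).2 ?_).trans
            (_root_.map_add ((unitsFiltered G R).toSubquotient a b) ⟨_, h.unit_mem x⟩ ⟨_, h.unit_mem y⟩)
        rw [Units.val_mul, coe_unit, coe_unit, coe_unit]
        exact h.map_add _ x.2 _ y.2
  -- Scalars act through integers, so additivity suffices.
  { φ with map_smul' := fun n x => map_zsmul φ n.toInt x }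

theorem toUnits_eq (x : (addFiltered G R).fil a) {u : Rˣ}
    (hu : Additive.ofMul u ∈ (unitsFiltered G R).fil a) (hux : (u : R) = f x.1) :
    h.toUnits x = (unitsFiltered G R).toSubquotient a b ⟨Additive.ofMul u, hu⟩ :=
  (toSubquotient_units_eq_iff (h.unit_mem x) hu).2 (by
    rw [coe_unit, hux, sub_self]; exact Ideal.zero_mem _)

theorem toUnits_surjective : Function.Surjective h.toUnits := by
  intro y
  obtain ⟨⟨u, hu⟩, rfl⟩ := Submodule.Quotient.mk_surjective _ y
  obtain ⟨x, hx, hux⟩ := h.exists_sub_mem _ (mem_unitsFiltered (G := G) (u := u.toMul).1 hu)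
  refine ⟨⟨x, hx⟩, Eq.symm ((toSubquotient_units_eq_iff (u := u.toMul) hu (h.unit_mem _)).2 ?_)⟩
  rwa [coe_unit]

theorem ker_toUnits :
    LinearMap.ker h.toUnits = ((addFiltered G R).fil b).submoduleOf ((addFiltered G R).fil a) := by
  ext x
  rw [LinearMap.mem_ker]
  refine ((unitsFiltered G R).toSubquotient_eq_zero_iff (s := a) (t := b) ⟨_, h.unit_mem x⟩).trans ?_
  refine mem_unitsFiltered.trans ?_
  rw [coe_unit]
  exact h.sub_one_mem_iff x.1 (h.mem_maximalIdeal x.2) b.toNat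

/-- The isomorphism `𝔫^a / 𝔫^b ≅ (1 + 𝔫^a) / (1 + 𝔫^b)` induced by `f`. -/
def iso : (addFiltered G R).subquotient a b ≅ (unitsFiltered G R).subquotient a b :=
  Rep.mkIso (.mk ((Submodule.quotEquivOfEq _ _ h.ker_toUnits.symm).trans
    (h.toUnits.quotKerEquivOfSurjective h.toUnits_surjective))
    (by
      intro g
      ext x
      have hg : (h.unit x : R) = f x.1 := h.coe_unit x
      -- The translate by `g` of the unit chosen for `x` need not be the one chosen for `g • x`; it
      -- only has to have the value `f (g • x)`.
      refine h.toUnits_eq ⟨_, (addFiltered G R).stable a g x.2⟩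
        (u := Units.map (MulSemiringAction.toRingHom G R g : R →* R) (h.unit x))
        ((unitsFiltered G R).stable a g (h.unit_mem x)) ?_
      refine Eq.trans ?_ (h.map_smul g x.1).symm
      rw [← hg]
      rfl))

theorem iso_hom_toSubquotient (x : (addFiltered G R).fil a) {u : Rˣ}
    (hu : Additive.ofMul u ∈ (unitsFiltered G R).fil a) (hux : (u : R) = f x.1) :
    h.iso.hom.hom ((addFiltered G R).toSubquotient a b x) =
      (unitsFiltered G R).toSubquotient a b ⟨Additive.ofMul u, hu⟩ :=
  h.toUnits_eq x hu hux

/-- On representatives both sides are membership in a step of index `min t b`, and `sub_one_mem_iff`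
for that exponent compares them. -/
theorem mem_trunc_fil_iff (t : ℤ) (x : ((addFiltered G R).trunc a b).V) :
    x ∈ ((addFiltered G R).trunc a b).fil t ↔
      h.iso.hom.hom x ∈ ((unitsFiltered G R).trunc a b).fil t := by
  obtain ⟨x, rfl⟩ := Submodule.Quotient.mk_surjective _ x
  refine (FilteredRep.mem_trunc_fil x).trans ?_
  refine Iff.trans ?_ (Iff.of_eq (congrArg (· ∈ ((unitsFiltered G R).trunc a b).fil t)
    (h.iso_hom_toSubquotient x (h.unit_mem x) (h.coe_unit x)).symm))
  refine Iff.trans ?_ (FilteredRep.mem_trunc_fil _).symm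
  refine Iff.trans ?_ mem_unitsFiltered.symm
  rw [coe_unit]
  exact (h.sub_one_mem_iff x.1 (h.mem_maximalIdeal x.2) _).symm

end IsTruncIso

theorem isTruncIso_truncExp {p k : ℕ} (hp : 2 ≤ p)
    (hfac : IsUnit ((Nat.factorial (p - 1) : ℕ) : R)) (hk : 1 ≤ k) :
    IsTruncIso G (truncExp (R := R) p) (k : ℤ) (p * k : ℤ) where
  one_le := by lia
  sub_one_mem_iff x hx n := truncExp_sub_one_mem_iff hp hx
  map_add x hx y hy := by
    -- Here `I = 𝔫^k`, so the error lies in `I^p = 𝔫^{pk}`; this is where the upper bound of the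
    -- truncation comes from.
    have := truncExp_mul_sub_mem hfac hx hy
    rw [← pow_mul, mul_comm] at this
    rw [← neg_mem_iff, neg_sub]
    exact this
  map_smul g x := (smul_truncExp g p x).symm
  exists_sub_mem y hy := exists_sub_truncExp_mem hp hk
    (show k ≤ (p * k : ℤ).toNat by rw [← Nat.cast_mul, Int.toNat_natCast]; nlinarith) hy

theorem isTruncIso_one_add {t : ℤ} (ht : 1 ≤ t) :
    IsTruncIso G (fun x : R => 1 + x) t (t + 1) where
  one_le := ht
  sub_one_mem_iff x hx n := by rw [add_sub_cancel_left]
  map_add x hx y hy := by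
    have : 1 + (x + y) - (1 + x) * (1 + y) = -(x * y) := by ring
    rw [this, neg_mem_iff]
    -- The defect `xy` lies in `𝔫^{2t}`, and `2t ≥ t + 1` because `t ≥ 1`.
    refine Ideal.pow_le_pow_right (show (t + 1).toNat ≤ t.toNat + t.toNat by lia) ?_
    rw [pow_add]
    exact Ideal.mul_mem_mul hx hy
  map_smul g x := by rw [smul_add, smul_one]
  exists_sub_mem y hy := ⟨y - 1, hy, by simp⟩

end

end

/-! ### Assembly of the theorem -/

theorem mainTheorem11 {G R : Type u} [Group G] [Finite G] [CommRing R] [IsLocalRing R]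
    [IsNoetherianRing R] [MulSemiringAction G R] (p : ℕ) (hp : p.Prime)
    (hfac : IsUnit ((Nat.factorial (p - 1) : ℕ) : R)) (k : ℕ) (hk : 1 ≤ k) :
    ∃ (Φ : (addTrunc G R p k).V ≅ (unitsTrunc G R p k).V)
      (γ : ∀ t : ℤ, 1 ≤ t → ((addFiltered G R).gr t ≅ (unitsFiltered G R).gr t))
      (e : (addTrunc G R p k).cochains.spectralSequence ≅
        (unitsTrunc G R p k).cochains.spectralSequence),
      -- `Φ` is the `p`-truncated exponential, and it identifies the filtrations
      (∀ (x : R) (hx : x ∈ (addFiltered G R).fil k),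
        ∃ (u : Rˣ) (hu : Additive.ofMul u ∈ (unitsFiltered G R).fil k),
          (u : R) = truncExp p x ∧
          Φ.hom ((addFiltered G R).toSubquotient k (p * k) ⟨x, hx⟩) =
            (unitsFiltered G R).toSubquotient k (p * k) ⟨Additive.ofMul u, hu⟩) ∧
      (∀ (t : ℤ) (x : (addTrunc G R p k).V),
        x ∈ (addTrunc G R p k).fil t ↔ Φ.hom x ∈ (unitsTrunc G R p k).fil t) ∧
      -- `γ` is the natural identification `𝔫^t / 𝔫^{t+1} ≅ (1 + 𝔫^t) / (1 + 𝔫^{t+1})`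
      (∀ (t : ℤ) (ht : 1 ≤ t) (x : R) (hx : x ∈ (addFiltered G R).fil t),
        ∃ (u : Rˣ) (hu : Additive.ofMul u ∈ (unitsFiltered G R).fil t),
          (u : R) = 1 + x ∧
          (γ t ht).hom ((addFiltered G R).toSubquotient t (t + 1) ⟨x, hx⟩) =
            (unitsFiltered G R).toSubquotient t (t + 1) ⟨Additive.ofMul u, hu⟩) ∧
      -- on `E_1`-terms, `e` is the natural identification
      (∀ (s : ℕ) (t : ℤ) (hkt : (k : ℤ) ≤ t) (htp : t < p * k),
        (e.hom.hom 1 le_rfl).f (s, t) ≫ ((unitsFiltered G R).truncE1Iso hkt htp s).hom =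
          ((addFiltered G R).truncE1Iso hkt htp s).hom ≫
            (groupCohomology.functor ZU.{u} G s).map (γ t ((Nat.one_le_cast.2 hk).trans hkt)).hom) ∧
      -- `e` is induced by `Φ` on all pages
      (∀ (r : ℤ) (hr : 1 ≤ r) (s : ℕ) (t : ℤ) (z : (addTrunc G R p k).cochains.Z r t s)
        (w : (unitsTrunc G R p k).cochains.Z r t s),
        (∀ g : Fin s → G, w.1 g =
          Φ.hom (z.1 g)) →
        (e.hom.hom r hr).f (s, t) ((addTrunc G R p k).cochains.toPage r s t z) =
          (unitsTrunc G R p k).cochains.toPage r s t w) ∧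
      -- both spectral sequences are concentrated in the range `t ∈ [k, pk - 1]`
      (∀ (r : ℤ) (hr : 1 ≤ r) (s : ℕ) (t : ℤ), t < k ∨ (p * k : ℤ) ≤ t →
        Limits.IsZero (((addTrunc G R p k).cochains.spectralSequence.page r hr).X (s, t)) ∧
        Limits.IsZero (((unitsTrunc G R p k).cochains.spectralSequence.page r hr).X (s, t))) ∧
      -- `Φ` identifies the filtrations on the abutments
      (∀ (s : ℕ) (t : ℤ),
        ((addTrunc G R p k).cochains.homologyFil t s).map
          ((groupCohomology.functor ZU.{u} G s).map Φ.hom).hom =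
            (unitsTrunc G R p k).cochains.homologyFil t s) ∧
      -- both spectral sequences converge, and `e` on `E_∞` agrees with `Φ` on the abutments
      (∀ (r : ℤ) (hr : 1 ≤ r), ((p : ℤ) - 1) * k ≤ r → ∀ (s : ℕ) (t : ℤ),
        (k : ℤ) ≤ t → t < p * k →
        ∃ (ε : ((addTrunc G R p k).cochains.page r).X (s, t) ≃ₗ[ZU.{u}]
              (addTrunc G R p k).cochains.grHomology t s)
          (ε' : ((unitsTrunc G R p k).cochains.page r).X (s, t) ≃ₗ[ZU.{u}]
              (unitsTrunc G R p k).cochains.grHomology t s),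
          (addTrunc G R p k).cochains.IsEdgeEquiv r s t ε ∧
          (unitsTrunc G R p k).cochains.IsEdgeEquiv r s t ε' ∧
          ∀ (x : ((addTrunc G R p k).cochains.page r).X (s, t))
            (h : (addTrunc G R p k).cochains.homologyFil t s)
            (h' : (unitsTrunc G R p k).cochains.homologyFil t s),
            ε x = Submodule.Quotient.mk h →
            h'.1 =
              (groupCohomology.functor ZU.{u} G s).map Φ.hom h.1 →
            ε' ((e.hom.hom r hr).f (s, t) x) = Submodule.Quotient.mk h') := by

  have hp2 := hp.two_le
  have hΦ := isTruncIso_truncExp (G := G) hp2 hfac hk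
  have hto (t : ℤ) (x) (hx : x ∈ (addTrunc G R p k).fil t) :
      hΦ.iso.hom.hom x ∈ (unitsTrunc G R p k).fil t := (hΦ.mem_trunc_fil_iff t x).1 hx
  -- The filtration criterion for `Φ` is an equivalence, so applying it to `Φ⁻¹ y` shows that the
  -- inverse is filtered as well.
  have hinv (t : ℤ) (y) (hy : y ∈ (unitsTrunc G R p k).fil t) :
      hΦ.iso.inv.hom y ∈ (addTrunc G R p k).fil t :=
    (hΦ.mem_trunc_fil_iff t _).2 (Eq.subst (motive := (· ∈ (unitsTrunc G R p k).fil t))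
      (Rep.hom_inv_apply _ _ hΦ.iso y).symm hy)
  let f := FilteredRep.cochainsHom (A := addTrunc G R p k) (B := unitsTrunc G R p k) hΦ.iso.hom hto
  let f' := FilteredRep.cochainsHom (A := unitsTrunc G R p k) (B := addTrunc G R p k) hΦ.iso.inv hinv
  have hff' : f.φ ≫ f'.φ = 𝟙 _ :=
    (groupCohomology.cochainsMap_id_comp hΦ.iso.hom hΦ.iso.inv).symm.trans
      (by rw [hΦ.iso.hom_inv_id, groupCohomology.cochainsMap_id]; rfl)
  have hf'f : f'.φ ≫ f.φ = 𝟙 _ :=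
    (groupCohomology.cochainsMap_id_comp hΦ.iso.inv hΦ.iso.hom).symm.trans
      (by rw [hΦ.iso.inv_hom_id, groupCohomology.cochainsMap_id]; rfl)
  refine ⟨hΦ.iso, fun t ht => (isTruncIso_one_add ht).iso, f.spectralSequenceIso f' hff' hf'f,
    ?_, hΦ.mem_trunc_fil_iff, ?_, ?_, ?_, ?_, ?_, ?_⟩
  · intro x hx
    obtain ⟨u, hu, hu'⟩ := hΦ.exists_unit hx
    exact ⟨u, hu', hu, hΦ.iso_hom_toSubquotient ⟨x, hx⟩ hu' hu⟩
  · intro t ht x hx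
    obtain ⟨u, hu, hu'⟩ := (isTruncIso_one_add ht).exists_unit hx
    exact ⟨u, hu', hu, (isTruncIso_one_add ht).iso_hom_toSubquotient ⟨x, hx⟩ hu' hu⟩
  · intro s t hkt htp
    have ht : 1 ≤ t := (Nat.one_le_cast.2 hk).trans hkt
    refine FilteredRep.mapPage_truncE1Iso hkt htp hΦ.iso.hom hto
      (isTruncIso_one_add ht).iso.hom (fun x => ?_) s
    have hxk := (addFiltered G R).antitone hkt x.2
    obtain ⟨u, hu, hu'⟩ := hΦ.exists_unit hxk
    obtain ⟨v, hv, hv'⟩ := (isTruncIso_one_add (G := G) (R := R) ht).exists_unit x.2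
    -- The representatives to compare are `u = exp_p(x)` and `v = 1 + x`, which agree modulo
    -- `𝔫^{t+1}`.
    refine ⟨⟨Additive.ofMul u, ?_⟩, ⟨Additive.ofMul v, hv'⟩,
      hΦ.iso_hom_toSubquotient ⟨x, hxk⟩ hu' hu,
      (isTruncIso_one_add ht).iso_hom_toSubquotient x hv' hv, ?_⟩
    · refine mem_unitsFiltered.2 ?_
      rw [hu]
      exact (hΦ.sub_one_mem_iff _ (hΦ.mem_maximalIdeal hxk) _).2 x.2
    · have h1 := truncExp_sub_one_add_mem (R := R) hp2 (show 1 ≤ t.toNat by lia) x.2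
      rw [show t.toNat + 1 = (t + 1).toNat by lia] at h1
      have h2 : (u : R) - v ∈ IsLocalRing.maximalIdeal R ^ (t + 1).toNat := by rwa [hu, hv]
      exact sub_mem_unitsFiltered.2 h2
  · intro r hr s t z w h
    exact congrArg ((unitsTrunc G R p k).cochains.toPage r s t)
      (Subtype.ext (funext fun g => (h g).symm))
  · intro r hr s t h
    exact ⟨FilteredRep.isZero_trunc_page h s, FilteredRep.isZero_trunc_page h s⟩
  · intro s t
    exact f.map_homologyFil f' hf'f t s
  · intro r hr hpr s t hkt htp
    -- From `t ≥ k` and `r ≥ (p-1)k` the target step `F^{t+r}` is zero; from `t ≤ pk - 1` the source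
    -- step `F^{t-r+1}` is everything. This is why `(p-1)k` is the bound on `r`.
    have h1 : (p * k : ℤ) ≤ t + r := by linarith
    have h2 : t - r + 1 ≤ k := by linarith
    have hε := FilteredComplex.isEdgeEquiv_edgeEquiv (X := (addTrunc G R p k).cochains)
      (FilteredRep.trunc_cochains_F_eq_bot h1 (s + 1)) (FilteredRep.trunc_cochains_F_eq_top h2)
    have hε' := FilteredComplex.isEdgeEquiv_edgeEquiv (X := (unitsTrunc G R p k).cochains)
      (FilteredRep.trunc_cochains_F_eq_bot h1 (s + 1)) (FilteredRep.trunc_cochains_F_eq_top h2)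
    exact ⟨_, _, hε, hε', fun x h h' => hε.map_eq hε' f x h h'⟩
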